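/- **Lemma 3.4.** Let $G$ be a finite-dimensional Lie group, $M$ a $C^\infty$ manifold, and $p : E_G \to M$ a $C^\infty$ principal $G$-bundle, with $G$ acting on $E_G$ on the right. Let $\mathrm{At}(E_G) = (TE_G)/G \to M$ be its Atiyah bundle, whose fibre over $x$ is the space of $G$-invariant sections of $TE_G|_{p^{-1}(x)}$. Let $\eta : \mathrm{At}(E_G) \to TM$ be the surjection induced by $dp$, and $\mathrm{ad}(E_G) = \ker \eta$. A *connection* on $E_G$ is a $C^\infty$ homomorphism $D : TM \to \mathrm{At}(E_G)$ with $\eta \circ D = \mathrm{Id}_{TM}$. Equivalently, it is a $C^\infty$ homomorphism $\mathrm{At}(E_G) \to \mathrm{ad}(E_G)$ that is the identity on $\mathrm{ad}(E_G)$; the corresponding $D$ has as its image the kernel of this homomorphism. For a $C^\infty$ map $f : N \to M$, let $f^*E_G = N \times_M E_G$ be the pulled back principal $G$-bundle, let $\beta'_f : \mathrm{At}(f^*E_G) \to f^*\mathrm{At}(E_G)$ be the homomorphism induced by the differential of the projection $f^*E_G \to E_G$, and recall that $\beta'_f$ restricts to an isomorphism $\mathrm{ad}(f^*E_G) = f^*\mathrm{ad}(E_G)$.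 For a connection $D$ on $E_G$, the pullback $f^*D$ is the unique connection on $f^*E_G$ with $\beta'_f((f^*D)(v)) = D(df(v))$ for all $v \in TN$. Let $$\delta : \mathcal{C}(E_G) := (\eta \otimes \mathrm{Id}_{T^*M})^{-1}(\mathrm{Id}_{TM}) \subset \mathrm{At}(E_G) \otimes T^*M \longrightarrow M .$$ Thus a point $c$ of $\mathcal{C}(E_G)$ over $x$ is a linear map $c : T_xM \to \mathrm{At}(E_G)_x$ with $\eta \circ c = \mathrm{Id}$. Let $\beta : \delta^*\mathrm{At}(E_G) \to \delta^*\mathrm{ad}(E_G) = \mathrm{ad}(\delta^*E_G)$ be the homomorphism given at $c$ by $a \mapsto a - c(\eta(a))$. The *tautological connection* $\mathcal{D}_0$ on the principal $G$-bundle $\delta^*E_G \to \mathcal{C}(E_G)$ is the one given by the homomorphism $\beta \circ \beta'_\delta : \mathrm{At}(\delta^*E_G) \to \mathrm{ad}(\delta^*E_G)$. Let $\sigma : M \to \mathcal{C}(E_G)$ be a $C^\infty$ section of $\delta$, and let $D(\sigma)$ be the connection on $E_G$ corresponding to $\sigma$, that is, $D(\sigma)(v) = \sigma(x)(v)$ for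 $x \in M$ and $v \in T_xM$. Then, under the natural identification $\sigma^*\delta^*E_G = E_G$ that comes from $\delta \circ \sigma = \mathrm{Id}_M$, $$D(\sigma) = \sigma^*\mathcal{D}_0 .$$ -/

import Mathlib

open scoped Manifold ContDiff Topology
open Set Bundle

set_option linter.unusedSectionVars false

noncomputable section

/-! ### Preliminaries on smooth maps -/

section Prelim

variable {EY HY Y : Type*} [NormedAddCommGroup EY] [NormedSpace ℝ EY] [TopologicalSpace HY]
  {J : ModelWithCorners ℝ EY HY} [TopologicalSpace Y] [ChartedSpace HY Y]
  {F F' : Type*} [NormedAddCommGroup F] [NormedSpace ℝ F] [FiniteDimensional ℝ F]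
  [NormedAddCommGroup F'] [NormedSpace ℝ F']

theorem contMDiffWithinAt_clm_of_apply {A : Y → F →L[ℝ] F'} {s : Set Y} {y : Y}
    (h : ∀ v, ContMDiffWithinAt J 𝓘(ℝ, F') ∞ (fun y => A y v) s y) :
    ContMDiffWithinAt J 𝓘(ℝ, F →L[ℝ] F') ∞ A s y := by
  let b := Module.finBasis ℝ F
  have hA : A = fun y => ∑ i, (ContinuousLinearMap.smulRightL ℝ F F'
      (LinearMap.toContinuousLinearMap (b.coord i))) (A y (b i)) := by
    funext y
    ext v
    conv_lhs => rw [← b.sum_repr v, map_sum]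
    simp
  rw [hA]
  refine ContMDiffWithinAt.sum fun i _ => ?_
  exact (ContinuousLinearMap.contMDiff _).contMDiffAt.comp_contMDiffWithinAt y (h (b i))

variable {EW HW W : Type*} [NormedAddCommGroup EW] [NormedSpace ℝ EW] [TopologicalSpace HW]
  {I : ModelWithCorners ℝ EW HW} [TopologicalSpace W] [ChartedSpace HW W] [IsManifold I ∞ W]
  {EV HV V : Type*} [NormedAddCommGroup EV] [NormedSpace ℝ EV] [TopologicalSpace HV]
  {K : ModelWithCorners ℝ EV HV} [TopologicalSpace V] [ChartedSpace HV V] [IsManifold K ∞ V]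

theorem contMDiffOn_mfderiv_comp {f : W → V} {O : Set W} (hf : ContMDiffOn I K ∞ f O)
    (hO : IsOpen O) {b : Y → W} {w : ∀ y, TangentSpace I (b y)} {S : Set Y}
    (hw : ContMDiffOn J I.tangent ∞ (fun y => (⟨b y, w y⟩ : TangentBundle I W)) S)
    (hS : ∀ y ∈ S, b y ∈ O) :
    ContMDiffOn J K.tangent ∞
      (fun y => (⟨f (b y), mfderiv I K f (b y) (w y)⟩ : TangentBundle K V)) S := by
  have := (hf.contMDiffOn_tangentMapWithin (m := ∞) (by simp) hO.uniqueMDiffOn).comp hw hS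
  refine this.congr fun y hy => ?_
  simp [tangentMapWithin, mfderivWithin_of_isOpen hO (hS y hy)]

end Prelim

/-! ### Embedded submanifolds -/

section Slices

variable {EW HW W : Type*} [NormedAddCommGroup EW] [NormedSpace ℝ EW] [TopologicalSpace HW]
  [TopologicalSpace W] [ChartedSpace HW W]

/-- A local parametrization of a subset `S` of a manifold `W` around a point `c` of `S`: the smooth map
`toFun` on the open set `source` of `W` restricts to a bijection from `S ∩ source` onto the open
set `target` of `F`, whose inverse `invFun` is smooth as a map to `W`. -/
structure LocalSlice (I : ModelWithCorners ℝ EW HW) (F : Type*) [NormedAddCommGroup F]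
    [NormedSpace ℝ F] (S : Set W) (c : S) where
  source : Set W
  target : Set F
  toFun : W → F
  invFun : F → W
  isOpen_source : IsOpen source
  isOpen_target : IsOpen target
  mem_source : (c : W) ∈ source
  mapsTo : ∀ w ∈ source, w ∈ S → toFun w ∈ target
  inv_mem_source : ∀ u ∈ target, invFun u ∈ source
  inv_mem : ∀ u ∈ target, invFun u ∈ S
  left_inv : ∀ w ∈ source, w ∈ S → invFun (toFun w) = w
  right_inv : ∀ u ∈ target, toFun (invFun u) = u
  contMDiffOn_toFun : ContMDiffOn I 𝓘(ℝ, F) ∞ toFun source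
  contMDiffOn_invFun : ContMDiffOn 𝓘(ℝ, F) I ∞ invFun target

variable {I : ModelWithCorners ℝ EW HW} {F : Type*} [NormedAddCommGroup F] [NormedSpace ℝ F]
  {S : Set W}

namespace LocalSlice

open Classical in
/-- The chart of `S` given by a slice. -/
def chart {c : S} (σ : LocalSlice I F S c) : OpenPartialHomeomorph S F where
  toFun x := σ.toFun x
  invFun u := if h : σ.invFun u ∈ S then ⟨σ.invFun u, h⟩ else c
  source := {x | (x : W) ∈ σ.source}
  target := σ.target
  map_source' x hx := σ.mapsTo x hx x.2
  map_target' u hu := by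
    simpa [dif_pos (σ.inv_mem u hu)] using σ.inv_mem_source u hu
  left_inv' x hx := by
    have h := σ.left_inv x hx x.2
    apply Subtype.ext
    rw [dif_pos (by rw [h]; exact x.2)]
    exact h
  right_inv' u hu := by
    rw [dif_pos (σ.inv_mem u hu)]
    exact σ.right_inv u hu
  open_source := σ.isOpen_source.preimage continuous_subtype_val
  open_target := σ.isOpen_target
  continuousOn_toFun := σ.contMDiffOn_toFun.continuousOn.comp
    continuous_subtype_val.continuousOn fun _ hx => hx
  continuousOn_invFun := by
    rw [Topology.IsInducing.subtypeVal.continuousOn_iff]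
    refine σ.contMDiffOn_invFun.continuousOn.congr fun u hu => ?_
    simp [dif_pos (σ.inv_mem u hu)]

theorem chart_apply {c : S} (σ : LocalSlice I F S c) (x : S) : σ.chart x = σ.toFun x := rfl

open Classical in
theorem coe_chart_symm {c : S} (σ : LocalSlice I F S c) {u : F} (hu : u ∈ σ.target) :
    (σ.chart.symm u : W) = σ.invFun u := by
  change ((dite _ _ _ : S) : W) = _
  rw [dif_pos (σ.inv_mem u hu)]

/-- A choice of slices around all points of a subset makes it a manifold (with the subspace
topology). -/
@[reducible]
def chartedSpace (σ : ∀ c, LocalSlice I F S c) : ChartedSpace F S where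
  atlas := range fun c => (σ c).chart
  chartAt c := (σ c).chart
  mem_chart_source c := (σ c).mem_source
  chart_mem_atlas c := ⟨c, rfl⟩

theorem isManifold (σ : ∀ c, LocalSlice I F S c) :
    @IsManifold ℝ _ F _ _ F _ 𝓘(ℝ, F) ∞ S _ (chartedSpace σ) := by
  letI := chartedSpace σ
  refine isManifold_of_contDiffOn _ _ _ ?_
  rintro _ _ ⟨c, rfl⟩ ⟨d, rfl⟩
  rw [← contMDiffOn_iff_contDiffOn]
  have : ContMDiffOn 𝓘(ℝ, F) 𝓘(ℝ, F) ∞ ((σ d).toFun ∘ (σ c).invFun)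
      ((σ c).target ∩ (σ c).invFun ⁻¹' (σ d).source) :=
    (σ d).contMDiffOn_toFun.comp ((σ c).contMDiffOn_invFun.mono inter_subset_left)
      fun x hx => hx.2
  refine (this.congr ?_).mono ?_
  · intro u hu
    simp only [modelWithCornersSelf_coe, modelWithCornersSelf_coe_symm, Function.comp_apply, id,
      OpenPartialHomeomorph.coe_trans, chart_apply]
    rw [coe_chart_symm _ hu.1]
  · intro u hu
    simp only [modelWithCornersSelf_coe, modelWithCornersSelf_coe_symm, preimage_id, range_id,
      inter_univ, OpenPartialHomeomorph.trans_source, OpenPartialHomeomorph.symm_source] at hu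
    refine ⟨hu.1, ?_⟩
    have h2 : (((σ c).chart.symm u : S) : W) ∈ (σ d).source := hu.2
    rwa [coe_chart_symm _ hu.1] at h2

theorem contMDiff_coe (σ : ∀ c, LocalSlice I F S c) :
    letI := chartedSpace σ
    ContMDiff 𝓘(ℝ, F) I ∞ (fun x : S => (x : W)) := by
  letI := chartedSpace σ
  have := isManifold σ
  intro c
  have h1 : ContMDiffOn 𝓘(ℝ, F) 𝓘(ℝ, F) ∞ (chartAt F c) (chartAt F c).source :=
    contMDiffOn_chart
  have h2 : ContMDiffOn 𝓘(ℝ, F) I ∞ ((σ c).invFun ∘ (chartAt F c)) (chartAt F c).source :=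
    (σ c).contMDiffOn_invFun.comp h1 fun x hx => (σ c).mapsTo x hx x.2
  refine (h2.congr ?_).contMDiffAt ((chartAt F c).open_source.mem_nhds (mem_chart_source F c))
  intro x hx
  exact ((σ c).left_inv x hx x.2).symm

variable {EY HY Y : Type*} [NormedAddCommGroup EY] [NormedSpace ℝ EY] [TopologicalSpace HY]
  {J : ModelWithCorners ℝ EY HY} [TopologicalSpace Y] [ChartedSpace HY Y]

theorem contMDiffWithinAt_of_coe (σ : ∀ c, LocalSlice I F S c) {f : Y → S} {s : Set Y} {y : Y}
    (hf : ContMDiffWithinAt J I ∞ (fun y => (f y : W)) s y) :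
    letI := chartedSpace σ
    ContMDiffWithinAt J 𝓘(ℝ, F) ∞ f s y := by
  letI := chartedSpace σ
  have := isManifold σ
  have hcont : ContinuousWithinAt f s y :=
    Topology.IsInducing.subtypeVal.continuousWithinAt_iff.2 hf.continuousWithinAt
  rw [contMDiffWithinAt_iff_target]
  refine ⟨hcont, ?_⟩
  exact ContMDiffAt.comp_contMDiffWithinAt (g := (σ (f y)).toFun) (f := fun y => (f y : W)) y
    ((σ (f y)).contMDiffOn_toFun.contMDiffAt
      ((σ (f y)).isOpen_source.mem_nhds (σ (f y)).mem_source)) hf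

/-- The local retraction onto the submanifold given by a slice. -/
def retr {c : S} (σ : LocalSlice I F S c) (w : W) : S := σ.chart.symm (σ.toFun w)

/-- An open set on which the local retraction is smooth. -/
def retrSource {c : S} (σ : LocalSlice I F S c) : Set W := σ.source ∩ σ.toFun ⁻¹' σ.target

theorem isOpen_retrSource {c : S} (σ : LocalSlice I F S c) : IsOpen σ.retrSource :=
  σ.contMDiffOn_toFun.continuousOn.isOpen_inter_preimage σ.isOpen_source σ.isOpen_target

theorem mem_retrSource {c : S} (σ : LocalSlice I F S c) {x : S} (hx : (x : W) ∈ σ.source) :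
    (x : W) ∈ σ.retrSource := ⟨hx, σ.mapsTo x hx x.2⟩

theorem retr_coe {c : S} (σ : LocalSlice I F S c) {x : S} (hx : (x : W) ∈ σ.source) :
    σ.retr x = x := σ.chart.left_inv hx

theorem coe_retr {c : S} (σ : LocalSlice I F S c) {w : W} (hw : w ∈ σ.retrSource) :
    (σ.retr w : W) = σ.invFun (σ.toFun w) := coe_chart_symm σ hw.2

theorem contMDiffOn_retr (σ : ∀ c, LocalSlice I F S c) (c : S) :
    letI := chartedSpace σ
    ContMDiffOn I 𝓘(ℝ, F) ∞ (σ c).retr (σ c).retrSource := by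
  letI := chartedSpace σ
  intro w hw
  refine contMDiffWithinAt_of_coe σ ?_
  exact (((σ c).contMDiffOn_invFun.comp (s := (σ c).retrSource)
    ((σ c).contMDiffOn_toFun.mono inter_subset_left)
    fun w hw => hw.2).congr fun w hw => coe_retr (σ c) hw) w hw

theorem mfderiv_retr_coe (σ : ∀ c, LocalSlice I F S c) (c : S) {x : S}
    (hx : (x : W) ∈ (σ c).source) (t : F) :
    letI := chartedSpace σ
    mfderiv I 𝓘(ℝ, F) (σ c).retr x (mfderiv 𝓘(ℝ, F) I (fun x : S => (x : W)) x t) = t := by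
  letI := chartedSpace σ
  have h1 : MDifferentiableAt I 𝓘(ℝ, F) (σ c).retr (x : W) :=
    ((contMDiffOn_retr σ c).contMDiffAt ((σ c).isOpen_retrSource.mem_nhds
      ((σ c).mem_retrSource hx))).mdifferentiableAt (by simp)
  have h2 : MDifferentiableAt 𝓘(ℝ, F) I (fun x : S => (x : W)) x :=
    (contMDiff_coe σ).mdifferentiable (by simp) x
  have h3 := mfderiv_comp x h1 h2
  have h4 : (σ c).retr ∘ (fun x : S => (x : W)) =ᶠ[𝓝 x] id := by
    filter_upwards [((σ c).isOpen_source.preimage continuous_subtype_val).mem_nhds hx] with y hy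
      using retr_coe (σ c) hy
  rw [h4.mfderiv_eq, mfderiv_id] at h3
  exact (DFunLike.congr_fun h3 t).symm

/-- A map to the tangent bundle of a submanifold is smooth if it is smooth as a map to the tangent
bundle of the ambient manifold. -/
theorem contMDiffOn_tangent_of_coe [IsManifold I ∞ W] (σ : ∀ c, LocalSlice I F S c)
    {b : Y → S} {t : Y → F} {U : Set Y} (hU : IsOpen U) :
    letI := chartedSpace σ
    haveI := isManifold σ
    ContMDiffOn J I.tangent ∞ (fun y => (⟨b y, mfderiv 𝓘(ℝ, F) I (fun x : S => (x : W)) (b y)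
      (t y)⟩ : TangentBundle I W)) U →
    ContMDiffOn J (𝓘(ℝ, F).tangent) ∞ (fun y => (⟨b y, t y⟩ : TangentBundle 𝓘(ℝ, F) S)) U := by
  letI := chartedSpace σ
  haveI := isManifold σ
  intro h y hy
  have hb : ContMDiffOn J I ∞ (fun y => (b y : W)) U :=
    (contMDiff_proj (IB := I) (n := ∞) (F := EW) (TangentSpace I : W → Type _)).comp_contMDiffOn h
  let T := U ∩ (fun y => (b y : W)) ⁻¹' (σ (b y)).source
  have hT : IsOpen T := hb.continuousOn.isOpen_inter_preimage hU (σ (b y)).isOpen_source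
  have h1 := contMDiffOn_mfderiv_comp (contMDiffOn_retr σ (b y)) (σ (b y)).isOpen_retrSource
    (h.mono (inter_subset_left : T ⊆ U)) (fun z hz => (σ (b y)).mem_retrSource hz.2)
  refine ((h1.congr fun z hz => ?_).contMDiffAt
    (hT.mem_nhds ⟨hy, (σ (b y)).mem_source⟩)).contMDiffWithinAt
  rw [mfderiv_retr_coe σ (b y) hz.2 (t z), retr_coe (σ (b y)) hz.2]

end LocalSlice
end Slices

/-! ### Vector bundles from fibrewise linear trivializations -/

section Prebundle

variable {EB HB B : Type*} [NormedAddCommGroup EB] [NormedSpace ℝ EB] [TopologicalSpace HB]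
  {IB : ModelWithCorners ℝ EB HB} [TopologicalSpace B] [ChartedSpace HB B]
  {F : Type*} [NormedAddCommGroup F] [NormedSpace ℝ F]
  {E : B → Type*} [∀ x, AddCommGroup (E x)] [∀ x, Module ℝ (E x)] [∀ x, TopologicalSpace (E x)]

variable (IB F E) in
/-- A smooth vector bundle structure on a family of vector spaces, given by linear trivializations
over open sets with smooth transition functions. -/
structure SmoothTrivializations where
  /-- the open set attached to the index `i`, a neighbourhood of `i` -/
  source : B → Set B
  isOpen_source : ∀ i, IsOpen (source i)
  mem_source : ∀ i, i ∈ source i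
  /-- the trivialization over `source i` -/
  equiv : ∀ i x, x ∈ source i → (E x ≃L[ℝ] F)
  /-- the transition functions -/
  trans : B → B → B → F →L[ℝ] F
  trans_eq : ∀ i j x (hi : x ∈ source i) (hj : x ∈ source j) v,
    trans i j x v = equiv j x hj ((equiv i x hi).symm v)
  contMDiffOn_trans : ∀ i j, ContMDiffOn IB 𝓘(ℝ, F →L[ℝ] F) ∞ (trans i j) (source i ∩ source j)

namespace SmoothTrivializations

variable (t : SmoothTrivializations IB F E)

open Classical in
/-- The local trivialization over `source i`. -/
def pretriv (i : B) : Pretrivialization F (π F E) where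
  toFun p := (p.1, if h : p.1 ∈ t.source i then t.equiv i p.1 h p.2 else 0)
  invFun q := ⟨q.1, if h : q.1 ∈ t.source i then (t.equiv i q.1 h).symm q.2 else 0⟩
  source := π F E ⁻¹' t.source i
  target := t.source i ×ˢ univ
  map_source' p hp := ⟨hp, trivial⟩
  map_target' q hq := hq.1
  left_inv' := by
    rintro ⟨x, a⟩ hx
    have hx : x ∈ t.source i := hx
    simp [hx]
  right_inv' := by
    rintro ⟨x, v⟩ hx
    have hx : x ∈ t.source i := hx.1
    simp [hx]
  open_target := (t.isOpen_source i).prod isOpen_univ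
  baseSet := t.source i
  open_baseSet := t.isOpen_source i
  source_eq := rfl
  target_eq := rfl
  proj_toFun p hp := rfl

theorem pretriv_apply (i : B) {x : B} (hx : x ∈ t.source i) (a : E x) :
    t.pretriv i ⟨x, a⟩ = (x, t.equiv i x hx a) := by
  exact congrArg (Prod.mk x) (dif_pos hx)

theorem pretriv_symm_apply (i : B) {x : B} (hx : x ∈ t.source i) (v : F) :
    (t.pretriv i).symm x v = (t.equiv i x hx).symm v := by
  have hx' : x ∈ (t.pretriv i).baseSet := hx
  have h := (t.pretriv i).mk_symm hx' v
  have h2 : (t.pretriv i).toPartialEquiv.symm (x, v) = ⟨x, (t.equiv i x hx).symm v⟩ := by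
    exact congrArg (TotalSpace.mk x) (dif_pos hx)
  rw [h2] at h
  simpa using h

theorem pretriv_isLinear (i : B) : (t.pretriv i).IsLinear ℝ where
  linear x hx := by
    have hx : x ∈ t.source i := hx
    constructor <;> intros <;> simp [t.pretriv_apply i hx]

theorem exists_trans (i j : B) : ∃ f : B → F →L[ℝ] F,
    ContMDiffOn IB 𝓘(ℝ, F →L[ℝ] F) ∞ f ((t.pretriv i).baseSet ∩ (t.pretriv j).baseSet) ∧
      ∀ b ∈ (t.pretriv i).baseSet ∩ (t.pretriv j).baseSet, ∀ v : F,
        f b v = (t.pretriv j ⟨b, (t.pretriv i).symm b v⟩).2 := by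
  refine ⟨t.trans i j, t.contMDiffOn_trans i j, fun b hb v => ?_⟩
  rw [t.pretriv_symm_apply i hb.1, t.pretriv_apply j hb.2, t.trans_eq i j b hb.1 hb.2]

/-- The vector bundle structure defined by the trivializations. -/
def prebundle : VectorPrebundle ℝ F E where
  pretrivializationAtlas := range t.pretriv
  pretrivialization_linear' := by
    rintro _ ⟨i, rfl⟩
    exact t.pretriv_isLinear i
  pretrivializationAt := t.pretriv
  mem_base_pretrivializationAt x := t.mem_source x
  pretrivialization_mem_atlas x := ⟨x, rfl⟩
  exists_coordChange := by
    rintro _ ⟨i, rfl⟩ _ ⟨j, rfl⟩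
    obtain ⟨f, hf, h⟩ := t.exists_trans i j
    exact ⟨f, hf.continuousOn, h⟩
  totalSpaceMk_isInducing b := by
    have h : (t.pretriv b : TotalSpace F E → B × F) ∘ TotalSpace.mk b
        = Prod.mk b ∘ t.equiv b b (t.mem_source b) := by
      funext a
      exact t.pretriv_apply b (t.mem_source b) a
    rw [h]
    exact (Topology.isInducing_const_prod.2 Topology.IsInducing.id).comp
      (t.equiv b b (t.mem_source b)).toHomeomorph.isInducing

theorem isContMDiff : t.prebundle.IsContMDiff IB ∞ where
  exists_contMDiffCoordChange := by
    rintro _ ⟨i, rfl⟩ _ ⟨j, rfl⟩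
    exact t.exists_trans i j

variable {EY HY Y : Type*} [NormedAddCommGroup EY] [NormedSpace ℝ EY] [TopologicalSpace HY]
  {J : ModelWithCorners ℝ EY HY} [TopologicalSpace Y] [ChartedSpace HY Y]

theorem contMDiffWithinAt_iff {f : Y → TotalSpace F E} {s : Set Y} {y : Y} :
    letI := t.prebundle.totalSpaceTopology
    letI := t.prebundle.toFiberBundle
    ContMDiffWithinAt J (IB.prod 𝓘(ℝ, F)) ∞ f s y ↔
      ContMDiffWithinAt J IB ∞ (fun y => (f y).1) s y ∧
      ContMDiffWithinAt J 𝓘(ℝ, F) ∞ (fun z => (t.pretriv (f y).1 (f z)).2) s y := by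
  letI := t.prebundle.totalSpaceTopology
  letI := t.prebundle.toFiberBundle
  exact Bundle.contMDiffWithinAt_totalSpace

end SmoothTrivializations

end Prebundle

section TangentCoordinates

variable {EY HY Y : Type*} [NormedAddCommGroup EY] [NormedSpace ℝ EY] [TopologicalSpace HY]
  {J : ModelWithCorners ℝ EY HY} [TopologicalSpace Y] [ChartedSpace HY Y]
  {FP P : Type*} [NormedAddCommGroup FP] [NormedSpace ℝ FP] [TopologicalSpace P]
  [ChartedSpace FP P] [IsManifold 𝓘(ℝ, FP) ∞ P]

/-- The local trivialization of the tangent bundle given by the preferred chart at `z₀`. -/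
abbrev tangentTriv (FP : Type*) {P : Type*} [NormedAddCommGroup FP] [NormedSpace ℝ FP]
    [TopologicalSpace P] [ChartedSpace FP P] [IsManifold 𝓘(ℝ, FP) ∞ P] (z₀ : P) :
    Trivialization FP (π FP (TangentSpace 𝓘(ℝ, FP) : P → Type _)) :=
  trivializationAt FP (TangentSpace 𝓘(ℝ, FP) : P → Type _) z₀

theorem contMDiffOn_tangentTriv (z₀ : P) {b : Y → P} {w : ∀ y, TangentSpace 𝓘(ℝ, FP) (b y)}
    {S : Set Y}
    (hw : ContMDiffOn J 𝓘(ℝ, FP).tangent ∞ (fun y => (⟨b y, w y⟩ : TangentBundle 𝓘(ℝ, FP) P)) S)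
    (hS : ∀ y ∈ S, b y ∈ (tangentTriv FP z₀).baseSet) :
    ContMDiffOn J 𝓘(ℝ, FP) ∞
      (fun y => (tangentTriv FP z₀).continuousLinearMapAt ℝ (b y) (w y)) S := by
  have h := (((tangentTriv FP z₀).contMDiffOn_iff (IB := 𝓘(ℝ, FP)) (n := ∞)
    (fun y hy => (tangentTriv FP z₀).mem_source.2 (hS y hy))).1 hw).2
  refine h.congr fun y hy => ?_
  rw [Trivialization.continuousLinearMapAt_apply, Trivialization.linearMapAt_apply,
    if_pos (hS y hy)]

theorem contMDiffOn_tangentTriv_symm (z₀ : P) {b : Y → P} {v : Y → FP} {S : Set Y}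
    (hb : ContMDiffOn J 𝓘(ℝ, FP) ∞ b S) (hv : ContMDiffOn J 𝓘(ℝ, FP) ∞ v S)
    (hS : ∀ y ∈ S, b y ∈ (tangentTriv FP z₀).baseSet) :
    ContMDiffOn J 𝓘(ℝ, FP).tangent ∞
      (fun y => (⟨b y, (tangentTriv FP z₀).symmL ℝ (b y) (v y)⟩ : TangentBundle 𝓘(ℝ, FP) P)) S := by
  have h := ((tangentTriv FP z₀).contMDiffOn_symm (IB := 𝓘(ℝ, FP)) (n := ∞)).comp
    (hb.prodMk hv) (fun y hy => (tangentTriv FP z₀).mem_target.2 (hS y hy))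
  refine h.congr fun y hy => ?_
  rw [Trivialization.symmL_apply _ (hS y hy)]
  exact (tangentTriv FP z₀).mk_symm (hS y hy) (v y)

end TangentCoordinates

/-! ### Principal bundles -/

/-- A smooth principal `G`-bundle `P → M`: a smooth surjective submersion with a smooth right
action of `G` on `P`, preserving the fibres of `proj`, such that
`P × G → P ×_M P`, `(z, g) ↦ (z, z g)`, is a diffeomorphism. -/
structure PrincipalBundle
    (FG : Type*) [NormedAddCommGroup FG] [NormedSpace ℝ FG]
    (G : Type*) [TopologicalSpace G] [ChartedSpace FG G] [Group G]
    (FM : Type*) [NormedAddCommGroup FM] [NormedSpace ℝ FM]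
    (M : Type*) [TopologicalSpace M] [ChartedSpace FM M]
    (FP : Type*) [NormedAddCommGroup FP] [NormedSpace ℝ FP]
    (P : Type*) [TopologicalSpace P] [ChartedSpace FP P] where
  /-- the projection -/
  proj : P → M
  /-- the right action -/
  act : P → G → P
  contMDiff_proj : ContMDiff 𝓘(ℝ, FP) 𝓘(ℝ, FM) ∞ proj
  surjective_proj : Function.Surjective proj
  isSubmersion_proj : Manifold.IsSubmersion 𝓘(ℝ, FP) 𝓘(ℝ, FM) ∞ proj
  contMDiff_act : ContMDiff (𝓘(ℝ, FP).prod 𝓘(ℝ, FG)) 𝓘(ℝ, FP) ∞ (fun q : P × G => act q.1 q.2)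
  act_one : ∀ z, act z 1 = z
  act_mul : ∀ z g h, act z (g * h) = act (act z g) h
  proj_act : ∀ z g, proj (act z g) = proj z
  /-- The inverse of `(z, g) ↦ (z, z g)` has the form `(z, w) ↦ (z, τ z w)`, where `τ` is smooth on
  the fibre product. -/
  exists_div : ∃ τ : P → P → G, (∀ z g, τ z (act z g) = g) ∧
    (∀ z w, proj z = proj w → act z (τ z w) = w) ∧
    ContMDiffOn (𝓘(ℝ, FP).prod 𝓘(ℝ, FP)) 𝓘(ℝ, FG) ∞ (fun q : P × P => τ q.1 q.2)
      {q | proj q.1 = proj q.2}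

namespace PrincipalBundle

variable {FG : Type*} [NormedAddCommGroup FG] [NormedSpace ℝ FG]
    {G : Type*} [TopologicalSpace G] [ChartedSpace FG G] [Group G]
    {FM : Type*} [NormedAddCommGroup FM] [NormedSpace ℝ FM]
    {M : Type*} [TopologicalSpace M] [ChartedSpace FM M]
    {FP : Type*} [NormedAddCommGroup FP] [NormedSpace ℝ FP]
    {P : Type*} [TopologicalSpace P] [ChartedSpace FP P]
    (𝓟 : PrincipalBundle FG G FM M FP P)

/-- The group element moving `z` to `w`, for `z` and `w` in the same fibre. -/
def div : P → P → G := 𝓟.exists_div.choose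

theorem div_act (z : P) (g : G) : 𝓟.div z (𝓟.act z g) = g := 𝓟.exists_div.choose_spec.1 z g

theorem act_div {z w : P} (h : 𝓟.proj z = 𝓟.proj w) : 𝓟.act z (𝓟.div z w) = w :=
  𝓟.exists_div.choose_spec.2.1 z w h

theorem contMDiffOn_div : ContMDiffOn (𝓘(ℝ, FP).prod 𝓘(ℝ, FP)) 𝓘(ℝ, FG) ∞
    (fun q : P × P => 𝓟.div q.1 q.2) {q | 𝓟.proj q.1 = 𝓟.proj q.2} :=
  𝓟.exists_div.choose_spec.2.2

theorem div_eq {z w : P} {g : G} (h : 𝓟.act z g = w) : 𝓟.div z w = g := h ▸ 𝓟.div_act z g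

theorem contMDiff_actRight (g : G) : ContMDiff 𝓘(ℝ, FP) 𝓘(ℝ, FP) ∞ (fun z => 𝓟.act z g) :=
  𝓟.contMDiff_act.comp (contMDiff_id.prodMk contMDiff_const)

theorem mdifferentiableAt_actRight (g : G) (z : P) :
    MDifferentiableAt 𝓘(ℝ, FP) 𝓘(ℝ, FP) (fun z => 𝓟.act z g) z :=
  (𝓟.contMDiff_actRight g).mdifferentiable (by simp) z

theorem mdifferentiableAt_proj (z : P) : MDifferentiableAt 𝓘(ℝ, FP) 𝓘(ℝ, FM) 𝓟.proj z :=
  𝓟.contMDiff_proj.mdifferentiable (by simp) z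

theorem mfderiv_act_inl (z : P) (g : G) (w : TangentSpace 𝓘(ℝ, FP) z) :
    mfderiv (𝓘(ℝ, FP).prod 𝓘(ℝ, FG)) 𝓘(ℝ, FP) (fun q : P × G => 𝓟.act q.1 q.2) (z, g)
      ((w, (0 : FG)) : FP × FG) = mfderiv 𝓘(ℝ, FP) 𝓘(ℝ, FP) (fun y => 𝓟.act y g) z w := by
  have h1 : MDifferentiableAt (𝓘(ℝ, FP).prod 𝓘(ℝ, FG)) 𝓘(ℝ, FP)
      (fun q : P × G => 𝓟.act q.1 q.2) (z, g) := 𝓟.contMDiff_act.mdifferentiable (by simp) _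
  have h2 : MDifferentiableAt 𝓘(ℝ, FP) (𝓘(ℝ, FP).prod 𝓘(ℝ, FG)) (fun y : P => (y, g)) z :=
    (contMDiff_id.prodMk contMDiff_const).mdifferentiable (n := ∞) (by simp) z
  have h3 := mfderiv_comp z h1 h2
  have h4 : (fun q : P × G => 𝓟.act q.1 q.2) ∘ (fun y : P => (y, g)) = fun y => 𝓟.act y g := rfl
  rw [h4, mfderiv_prod_left] at h3
  rw [h3]
  rfl

theorem exists_localSection [IsManifold 𝓘(ℝ, FM) ∞ M] [IsManifold 𝓘(ℝ, FP) ∞ P] (z₀ : P) :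
    ∃ (s : M → P) (U : Set M), IsOpen U ∧ 𝓟.proj z₀ ∈ U ∧ s (𝓟.proj z₀) = z₀ ∧
      (∀ x ∈ U, 𝓟.proj (s x) = x) ∧ ContMDiffOn 𝓘(ℝ, FM) 𝓘(ℝ, FP) ∞ s U := by
  have h := (𝓟.isSubmersion_proj.isSubmersionAt z₀).isSubmersionAtOfComplement_complement
  let φ := h.domChart
  let ψ := h.codChart
  let e := h.equiv
  have hφ : z₀ ∈ φ.source := h.mem_domChart_source
  have hψ : 𝓟.proj z₀ ∈ ψ.source := h.mem_codChart_source
  have hsub : ∀ z ∈ φ.source, 𝓟.proj z ∈ ψ.source := h.source_subset_preimage_source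
  have hw : ∀ u ∈ φ.target, ψ (𝓟.proj (φ.symm u)) = (e u).1 := by
    intro u hu
    have hu' : u ∈ (φ.extend 𝓘(ℝ, FP)).target := by simpa using hu
    simpa using h.writtenInCharts hu'
  let j : FM → FP := fun u => e.symm (u, (e (φ z₀)).2)
  have hj : ContMDiff 𝓘(ℝ, FM) 𝓘(ℝ, FP) ∞ j := by
    rw [contMDiff_iff_contDiff]
    fun_prop
  have hψs : ContMDiffOn 𝓘(ℝ, FM) 𝓘(ℝ, FM) ∞ ψ ψ.source :=
    contMDiffOn_of_mem_maximalAtlas h.codChart_mem_maximalAtlas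
  have hφs : ContMDiffOn 𝓘(ℝ, FP) 𝓘(ℝ, FP) ∞ φ.symm φ.target :=
    contMDiffOn_symm_of_mem_maximalAtlas h.domChart_mem_maximalAtlas
  have hjψ : ContMDiffOn 𝓘(ℝ, FM) 𝓘(ℝ, FP) ∞ (fun x => j (ψ x)) ψ.source :=
    hj.comp_contMDiffOn hψs
  have hj0 : j (ψ (𝓟.proj z₀)) = φ z₀ := by
    have h1 := hw (φ z₀) (φ.map_source hφ)
    rw [φ.left_inv hφ] at h1
    simp only [j]
    rw [h1]
    simp
  refine ⟨fun x => φ.symm (j (ψ x)), ψ.source ∩ (fun x => j (ψ x)) ⁻¹' φ.target,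
    hjψ.continuousOn.isOpen_inter_preimage ψ.open_source φ.open_target, ⟨hψ, ?_⟩, ?_, ?_, ?_⟩
  · simpa [hj0] using φ.map_source hφ
  · simp only [hj0]
    exact φ.left_inv hφ
  · rintro x ⟨hx, hx'⟩
    have h1 := hw _ hx'
    have h2 : (e (j (ψ x))).1 = ψ x := by simp [j]
    rw [h2] at h1
    exact ψ.injOn (hsub _ (φ.map_target hx')) hx h1
  · exact hφs.comp (hjψ.mono inter_subset_left) fun x hx => hx.2

/-! ### The Atiyah bundle -/

/-- The fibre of a principal bundle over `x`. -/
abbrev Fiber (x : M) : Type _ := {z : P // 𝓟.proj z = x}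

variable {𝓟} in
/-- The action of `G` on a fibre. -/
def Fiber.act {x : M} (z : 𝓟.Fiber x) (g : G) : 𝓟.Fiber x :=
  ⟨𝓟.act z.1 g, (𝓟.proj_act z.1 g).trans z.2⟩

/-- The space of `G`-invariant sections of the restriction of `TP` to the fibre over `x`. -/
def invariantSections (x : M) :
    Submodule ℝ (∀ z : 𝓟.Fiber x, TangentSpace 𝓘(ℝ, FP) z.1) where
  carrier := {a | ∀ (z : 𝓟.Fiber x) (g : G),
    a (z.act g) = mfderiv 𝓘(ℝ, FP) 𝓘(ℝ, FP) (fun y => 𝓟.act y g) z.1 (a z)}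
  zero_mem' z g := (map_zero (mfderiv 𝓘(ℝ, FP) 𝓘(ℝ, FP) (fun y => 𝓟.act y g) z.1)).symm
  add_mem' {a b} ha hb z g := by
    have h := map_add (mfderiv 𝓘(ℝ, FP) 𝓘(ℝ, FP) (fun y => 𝓟.act y g) z.1) (a z) (b z)
    rw [← ha z g, ← hb z g] at h
    exact h.symm
  smul_mem' c a ha z g := by
    have h := map_smul (mfderiv 𝓘(ℝ, FP) 𝓘(ℝ, FP) (fun y => 𝓟.act y g) z.1) c (a z)
    rw [← ha z g] at h
    exact h.symm

/-- The fibre over `x` of the Atiyah bundle `TP / G`: the space of `G`-invariant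
sections of the restriction of `TP` to the fibre over `x`. -/
def Atiyah (x : M) : Type _ := 𝓟.invariantSections x

instance (x : M) : AddCommGroup (𝓟.Atiyah x) := inferInstanceAs (AddCommGroup (𝓟.invariantSections x))
instance (x : M) : Module ℝ (𝓟.Atiyah x) := inferInstanceAs (Module ℝ (𝓟.invariantSections x))
instance (x : M) : TopologicalSpace (𝓟.Atiyah x) :=
  inferInstanceAs (TopologicalSpace (𝓟.invariantSections x))
instance (x : M) : IsTopologicalAddGroup (𝓟.Atiyah x) :=
  inferInstanceAs (IsTopologicalAddGroup (𝓟.invariantSections x))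
instance (x : M) : ContinuousSMul ℝ (𝓟.Atiyah x) :=
  inferInstanceAs (ContinuousSMul ℝ (𝓟.invariantSections x))

variable {𝓟} in
/-- The value of an invariant section at a point of the fibre. -/
def Atiyah.eval {x : M} (a : 𝓟.Atiyah x) (z : 𝓟.Fiber x) : TangentSpace 𝓘(ℝ, FP) z.1 := a.1 z

variable {𝓟} in
theorem Atiyah.eval_act {x : M} (a : 𝓟.Atiyah x) (z : 𝓟.Fiber x) (g : G) :
    a.eval (z.act g) = mfderiv 𝓘(ℝ, FP) 𝓘(ℝ, FP) (fun y => 𝓟.act y g) z.1 (a.eval z) := a.2 z g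

variable {𝓟} in
theorem extend_mem {x : M} (z : 𝓟.Fiber x) (w : TangentSpace 𝓘(ℝ, FP) z.1) :
    (fun z' : 𝓟.Fiber x =>
      mfderiv 𝓘(ℝ, FP) 𝓘(ℝ, FP) (fun y => 𝓟.act y (𝓟.div z.1 z'.1)) z.1 w) ∈
      𝓟.invariantSections x := by
  intro z' g
  have h1 : 𝓟.act z.1 (𝓟.div z.1 z'.1) = z'.1 := 𝓟.act_div (z.2.trans z'.2.symm)
  have h2 : 𝓟.div z.1 (z'.act g).1 = 𝓟.div z.1 z'.1 * g :=
    𝓟.div_eq (by rw [𝓟.act_mul, h1]; rfl)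
  have h3 := mfderiv_comp z.1 (g := fun y => 𝓟.act y g)
    (f := fun y => 𝓟.act y (𝓟.div z.1 z'.1))
    (𝓟.mdifferentiableAt_actRight g _) (𝓟.mdifferentiableAt_actRight _ z.1)
  have h4 : (fun y => 𝓟.act y g) ∘ (fun y => 𝓟.act y (𝓟.div z.1 z'.1)) =
      fun y => 𝓟.act y (𝓟.div z.1 (z'.act g).1) := by
    funext y
    rw [h2]
    exact (𝓟.act_mul _ _ _).symm
  rw [h4, h1] at h3
  exact DFunLike.congr_fun h3 w

/-- An invariant section of `TP` over the fibre containing `z` is determined by its value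
at `z`, which can be arbitrary. -/
def evalEquiv {x : M} (z : 𝓟.Fiber x) : 𝓟.Atiyah x ≃L[ℝ] TangentSpace 𝓘(ℝ, FP) z.1 where
  toFun a := a.eval z
  map_add' _ _ := rfl
  map_smul' _ _ := rfl
  invFun w := ⟨_, extend_mem z w⟩
  left_inv a := by
    apply Subtype.ext
    funext z'
    have h := a.eval_act z (𝓟.div z.1 z'.1)
    have h1 : z.act (𝓟.div z.1 z'.1) = z' := Subtype.ext (𝓟.act_div (z.2.trans z'.2.symm))
    rw [h1] at h
    exact h.symm
  right_inv w := by
    have h : 𝓟.div z.1 z.1 = 1 := 𝓟.div_eq (𝓟.act_one _)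
    change mfderiv 𝓘(ℝ, FP) 𝓘(ℝ, FP) (fun y => 𝓟.act y (𝓟.div z.1 z.1)) z.1 w = w
    have h2 : (fun y => 𝓟.act y (𝓟.div z.1 z.1)) = id := by
      funext y
      rw [h, 𝓟.act_one]
      rfl
    rw [h2, mfderiv_id]
    rfl
  continuous_toFun := (continuous_apply z).comp continuous_subtype_val
  continuous_invFun := Continuous.subtype_mk (continuous_pi fun z' : 𝓟.Fiber x =>
    (mfderiv 𝓘(ℝ, FP) 𝓘(ℝ, FP) (fun y => 𝓟.act y (𝓟.div z.1 z'.1)) z.1).continuous) _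

end PrincipalBundle

namespace PrincipalBundle

variable {FG : Type*} [NormedAddCommGroup FG] [NormedSpace ℝ FG]
    {G : Type*} [TopologicalSpace G] [ChartedSpace FG G] [Group G] [LieGroup 𝓘(ℝ, FG) ∞ G]
    {FM : Type*} [NormedAddCommGroup FM] [NormedSpace ℝ FM]
    {M : Type*} [TopologicalSpace M] [ChartedSpace FM M] [IsManifold 𝓘(ℝ, FM) ∞ M]
    {FP : Type*} [NormedAddCommGroup FP] [NormedSpace ℝ FP] [FiniteDimensional ℝ FP]
    {P : Type*} [TopologicalSpace P] [ChartedSpace FP P] [IsManifold 𝓘(ℝ, FP) ∞ P]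
    (𝓟 : PrincipalBundle FG G FM M FP P)
    {EY HY Y : Type*} [NormedAddCommGroup EY] [NormedSpace ℝ EY] [TopologicalSpace HY]
    {J : ModelWithCorners ℝ EY HY} [TopologicalSpace Y] [ChartedSpace HY Y]

variable {𝓟} in
open Classical in
/-- The value of an invariant section at a point `z` of the fibre, extended by zero to all `z`. -/
def Atiyah.evalAt {x : M} (a : 𝓟.Atiyah x) (z : P) : TangentSpace 𝓘(ℝ, FP) z :=
  if h : 𝓟.proj z = x then a.eval ⟨z, h⟩ else 0

variable {𝓟} in
theorem Atiyah.evalAt_eq {x : M} (a : 𝓟.Atiyah x) {z : P} (h : 𝓟.proj z = x) :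
    a.evalAt z = a.eval ⟨z, h⟩ := dif_pos h

variable {𝓟} in
theorem Atiyah.mk_evalAt_act {x : M} (a : 𝓟.Atiyah x) {z z' : P} (g : G) (h : 𝓟.proj z = x)
    (hg : 𝓟.act z g = z') :
    (⟨z', a.evalAt z'⟩ : TangentBundle 𝓘(ℝ, FP) P) =
      ⟨𝓟.act z g, mfderiv 𝓘(ℝ, FP) 𝓘(ℝ, FP) (fun y => 𝓟.act y g) z (a.evalAt z)⟩ := by
  subst hg
  rw [a.evalAt_eq h, a.evalAt_eq ((𝓟.proj_act z g).trans h)]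
  exact congrArg (TotalSpace.mk _) (a.eval_act ⟨z, h⟩ g)

variable {𝓟} in
theorem contMDiffOn_evalAt_of_lift {b : Y → M} {a : ∀ y, 𝓟.Atiyah (b y)} {ζ ζ' : Y → P} {S : Set Y}
    (hζ : ContMDiffOn J 𝓘(ℝ, FP) ∞ ζ S) (hζ' : ContMDiffOn J 𝓘(ℝ, FP) ∞ ζ' S)
    (h : ∀ y ∈ S, 𝓟.proj (ζ y) = b y) (h' : ∀ y ∈ S, 𝓟.proj (ζ' y) = b y)
    (ha : ContMDiffOn J 𝓘(ℝ, FP).tangent ∞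
      (fun y => (⟨ζ y, (a y).evalAt (ζ y)⟩ : TangentBundle 𝓘(ℝ, FP) P)) S) :
    ContMDiffOn J 𝓘(ℝ, FP).tangent ∞
      (fun y => (⟨ζ' y, (a y).evalAt (ζ' y)⟩ : TangentBundle 𝓘(ℝ, FP) P)) S := by
  have hγ : ContMDiffOn J 𝓘(ℝ, FG) ∞ (fun y => 𝓟.div (ζ y) (ζ' y)) S :=
    𝓟.contMDiffOn_div.comp (hζ.prodMk hζ') fun y hy => (h y hy).trans (h' y hy).symm
  have h0 : ContMDiffOn J 𝓘(ℝ, FG).tangent ∞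
      (fun y => (⟨𝓟.div (ζ y) (ζ' y), 0⟩ : TangentBundle 𝓘(ℝ, FG) G)) S :=
    (contMDiff_zeroSection (n := ∞) ℝ (TangentSpace 𝓘(ℝ, FG) : G → Type _)).comp_contMDiffOn hγ
  have h1 := (contMDiff_equivTangentBundleProd_symm (n := ∞) (I := 𝓘(ℝ, FP)) (M := P)
    (I' := 𝓘(ℝ, FG)) (M' := G)).comp_contMDiffOn (ha.prodMk h0)
  have h2 := contMDiffOn_mfderiv_comp (b := fun y => (ζ y, 𝓟.div (ζ y) (ζ' y)))
    (w := fun y => ((a y).evalAt (ζ y), (0 : FG))) 𝓟.contMDiff_act.contMDiffOn isOpen_univ h1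
    (fun _ _ => trivial)
  refine h2.congr fun y hy => ?_
  rw [(a y).mk_evalAt_act (𝓟.div (ζ y) (ζ' y)) (h y hy)
    (𝓟.act_div ((h y hy).trans (h' y hy).symm))]
  exact congrArg (TotalSpace.mk _) (𝓟.mfderiv_act_inl _ _ _).symm

/-- A chosen point in each fibre. -/
def basePoint (x : M) : P := (𝓟.surjective_proj x).choose

theorem proj_basePoint (x : M) : 𝓟.proj (𝓟.basePoint x) = x := (𝓟.surjective_proj x).choose_spec

theorem exists_localSection_basePoint (i : M) :
    ∃ (s : M → P) (U : Set M), IsOpen U ∧ i ∈ U ∧ s i = 𝓟.basePoint i ∧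
      (∀ x ∈ U, 𝓟.proj (s x) = x) ∧ ContMDiffOn 𝓘(ℝ, FM) 𝓘(ℝ, FP) ∞ s U := by
  have h := 𝓟.exists_localSection (𝓟.basePoint i)
  generalize hb : 𝓟.basePoint i = z at h ⊢
  obtain rfl : 𝓟.proj z = i := hb ▸ 𝓟.proj_basePoint i
  exact h

/-- A local section of `P → M` through a chosen point in the fibre over `i`. -/
def localSection (i : M) : M → P := (𝓟.exists_localSection_basePoint i).choose

/-- The domain of a local section, shrunk so that the section takes values in a chart of `P`. -/
def sectionDomain (i : M) : Set M :=
  (𝓟.exists_localSection_basePoint i).choose_spec.choose ∩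
    𝓟.localSection i ⁻¹' (tangentTriv FP (𝓟.basePoint i)).baseSet

theorem contMDiffOn_localSection (i : M) :
    ContMDiffOn 𝓘(ℝ, FM) 𝓘(ℝ, FP) ∞ (𝓟.localSection i) (𝓟.sectionDomain i) :=
  (𝓟.exists_localSection_basePoint i).choose_spec.choose_spec.2.2.2.2.mono inter_subset_left

theorem isOpen_sectionDomain (i : M) : IsOpen (𝓟.sectionDomain i) :=
  (𝓟.exists_localSection_basePoint i).choose_spec.choose_spec.2.2.2.2.continuousOn
    |>.isOpen_inter_preimage (𝓟.exists_localSection_basePoint i).choose_spec.choose_spec.1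
      (tangentTriv FP (𝓟.basePoint i)).open_baseSet

theorem proj_localSection {i x : M} (hx : x ∈ 𝓟.sectionDomain i) :
    𝓟.proj (𝓟.localSection i x) = x :=
  (𝓟.exists_localSection_basePoint i).choose_spec.choose_spec.2.2.2.1 x hx.1

theorem localSection_self (i : M) : 𝓟.localSection i i = 𝓟.basePoint i :=
  (𝓟.exists_localSection_basePoint i).choose_spec.choose_spec.2.2.1

theorem mem_sectionDomain (i : M) : i ∈ 𝓟.sectionDomain i := by
  refine ⟨(𝓟.exists_localSection_basePoint i).choose_spec.choose_spec.2.1, ?_⟩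
  rw [mem_preimage, 𝓟.localSection_self i]
  exact mem_baseSet_trivializationAt _ _ _

/-- The linear coordinates on the fibres of the Atiyah bundle given by a local section. -/
def atiyahCoord (i x : M) (hx : x ∈ 𝓟.sectionDomain i) : 𝓟.Atiyah x ≃L[ℝ] FP :=
  (𝓟.evalEquiv ⟨𝓟.localSection i x, 𝓟.proj_localSection hx⟩).trans
    ((tangentTriv FP (𝓟.basePoint i)).continuousLinearEquivAt ℝ (𝓟.localSection i x) hx.2)

theorem atiyahCoord_apply {i x : M} (hx : x ∈ 𝓟.sectionDomain i) (a : 𝓟.Atiyah x) :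
    𝓟.atiyahCoord i x hx a = (tangentTriv FP (𝓟.basePoint i)).continuousLinearMapAt ℝ
      (𝓟.localSection i x) (a.evalAt (𝓟.localSection i x)) := by
  rw [a.evalAt_eq (𝓟.proj_localSection hx)]
  simp only [atiyahCoord, ContinuousLinearEquiv.trans_apply]
  rw [← Trivialization.coe_continuousLinearEquivAt_eq _ hx.2]
  rfl

theorem evalAt_atiyahCoord_symm {i x : M} (hx : x ∈ 𝓟.sectionDomain i) (v : FP) :
    ((𝓟.atiyahCoord i x hx).symm v).evalAt (𝓟.localSection i x) =
      (tangentTriv FP (𝓟.basePoint i)).symmL ℝ (𝓟.localSection i x) v := by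
  have h := 𝓟.atiyahCoord_apply hx ((𝓟.atiyahCoord i x hx).symm v)
  rw [ContinuousLinearEquiv.apply_symm_apply] at h
  conv_rhs => rw [h]
  rw [Trivialization.symmL_continuousLinearMapAt _ hx.2]

theorem contMDiffOn_atiyahCoord (i : M) {b : Y → M} {a : ∀ y, 𝓟.Atiyah (b y)} {S : Set Y}
    (hS : ∀ y ∈ S, b y ∈ 𝓟.sectionDomain i)
    (ha : ContMDiffOn J 𝓘(ℝ, FP).tangent ∞ (fun y => (⟨𝓟.localSection i (b y),
      (a y).evalAt (𝓟.localSection i (b y))⟩ : TangentBundle 𝓘(ℝ, FP) P)) S)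
    {c : Y → FP} (hc : ∀ y (hy : y ∈ S), c y = 𝓟.atiyahCoord i (b y) (hS y hy) (a y)) :
    ContMDiffOn J 𝓘(ℝ, FP) ∞ c S := by
  refine (contMDiffOn_tangentTriv (𝓟.basePoint i) ha fun y hy => (hS y hy).2).congr fun y hy => ?_
  rw [hc y hy, 𝓟.atiyahCoord_apply (hS y hy)]

open Classical in
/-- The smooth vector bundle structure of the Atiyah bundle: invariant sections are evaluated along
local sections of `P → M`, and the values are read in the charts of `TP`. -/
def atiyahTrivializations : SmoothTrivializations 𝓘(ℝ, FM) FP 𝓟.Atiyah where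
  source := 𝓟.sectionDomain
  isOpen_source := 𝓟.isOpen_sectionDomain
  mem_source := 𝓟.mem_sectionDomain
  equiv := 𝓟.atiyahCoord
  trans i j x := if h : x ∈ 𝓟.sectionDomain i ∧ x ∈ 𝓟.sectionDomain j then
    (𝓟.atiyahCoord j x h.2 : 𝓟.Atiyah x →L[ℝ] FP).comp
      ((𝓟.atiyahCoord i x h.1).symm : FP →L[ℝ] 𝓟.Atiyah x) else 0
  trans_eq i j x hi hj v := by
    rw [dif_pos ⟨hi, hj⟩]
    rfl
  contMDiffOn_trans i j := by
    intro x₀ hx₀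
    refine contMDiffWithinAt_clm_of_apply fun v => ?_
    let a : ∀ x, 𝓟.Atiyah x := fun x =>
      if h : x ∈ 𝓟.sectionDomain i then (𝓟.atiyahCoord i x h).symm v else 0
    have hi := (𝓟.contMDiffOn_localSection i).mono
      (inter_subset_left (s := 𝓟.sectionDomain i) (t := 𝓟.sectionDomain j))
    have hj := (𝓟.contMDiffOn_localSection j).mono
      (inter_subset_right (s := 𝓟.sectionDomain i) (t := 𝓟.sectionDomain j))
    have h1 := contMDiffOn_tangentTriv_symm (𝓟.basePoint i) hi
      (contMDiffOn_const (c := v)) (fun y hy => hy.1.2)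
    have h2 : ContMDiffOn 𝓘(ℝ, FM) 𝓘(ℝ, FP).tangent ∞ (fun y => (⟨𝓟.localSection i y,
      (a y).evalAt (𝓟.localSection i y)⟩ : TangentBundle 𝓘(ℝ, FP) P))
      (𝓟.sectionDomain i ∩ 𝓟.sectionDomain j) := by
      refine h1.congr fun y hy => ?_
      simp only [a, dif_pos hy.1]
      rw [𝓟.evalAt_atiyahCoord_symm hy.1]
    have h3 := contMDiffOn_evalAt_of_lift hi hj (fun y hy => 𝓟.proj_localSection hy.1)
      (fun y hy => 𝓟.proj_localSection hy.2) h2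
    refine 𝓟.contMDiffOn_atiyahCoord j (b := id) (fun y hy => hy.2) h3 (fun y hy => ?_) x₀ hx₀
    simp only [id, a, dif_pos (show y ∈ 𝓟.sectionDomain i ∧ y ∈ 𝓟.sectionDomain j from hy),
      dif_pos hy.1]
    rfl

instance : TopologicalSpace (TotalSpace FP 𝓟.Atiyah) :=
  𝓟.atiyahTrivializations.prebundle.totalSpaceTopology

instance : FiberBundle FP 𝓟.Atiyah := 𝓟.atiyahTrivializations.prebundle.toFiberBundle

instance : VectorBundle ℝ FP 𝓟.Atiyah := 𝓟.atiyahTrivializations.prebundle.toVectorBundle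

instance : ContMDiffVectorBundle ∞ FP 𝓟.Atiyah 𝓘(ℝ, FM) :=
  haveI := 𝓟.atiyahTrivializations.isContMDiff
  𝓟.atiyahTrivializations.prebundle.contMDiffVectorBundle 𝓘(ℝ, FM)

variable {𝓟} in
/-- A map into the Atiyah bundle is smooth if and only if its evaluation along a smooth lift
to `P` of the underlying map to `M` is smooth. -/
theorem contMDiffOn_atiyah_iff {b : Y → M} {a : ∀ y, 𝓟.Atiyah (b y)} {ζ : Y → P} {S : Set Y}
    (hS : IsOpen S)
    (hζ : ContMDiffOn J 𝓘(ℝ, FP) ∞ ζ S) (h : ∀ y ∈ S, 𝓟.proj (ζ y) = b y) :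
    ContMDiffOn J (𝓘(ℝ, FM).prod 𝓘(ℝ, FP)) ∞
      (fun y => (⟨b y, a y⟩ : TotalSpace FP 𝓟.Atiyah)) S ↔
    ContMDiffOn J 𝓘(ℝ, FP).tangent ∞
      (fun y => (⟨ζ y, (a y).evalAt (ζ y)⟩ : TangentBundle 𝓘(ℝ, FP) P)) S := by
  have hb : ContMDiffOn J 𝓘(ℝ, FM) ∞ b S :=
    (𝓟.contMDiff_proj.comp_contMDiffOn hζ).congr fun y hy => (h y hy).symm
  -- the domain of the local section at `b y`
  have hopen : ∀ y ∈ S, IsOpen (S ∩ b ⁻¹' 𝓟.sectionDomain (b y)) := fun y hy =>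
    hb.continuousOn.isOpen_inter_preimage hS (𝓟.isOpen_sectionDomain _)
  have hmem : ∀ y ∈ S, y ∈ S ∩ b ⁻¹' 𝓟.sectionDomain (b y) := fun y hy =>
    ⟨hy, 𝓟.mem_sectionDomain _⟩
  have hsec : ∀ y, ContMDiffOn J 𝓘(ℝ, FP) ∞ (fun z => 𝓟.localSection (b y) (b z))
      (S ∩ b ⁻¹' 𝓟.sectionDomain (b y)) := fun y =>
    (𝓟.contMDiffOn_localSection (b y)).comp (hb.mono inter_subset_left) fun z hz => hz.2
  have hcoord : ∀ (y z : Y) (hz : z ∈ S ∩ b ⁻¹' 𝓟.sectionDomain (b y)),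
      (𝓟.atiyahTrivializations.pretriv (b y) ⟨b z, a z⟩).2 =
      𝓟.atiyahCoord (b y) (b z) hz.2 (a z) := by
    intro y z hz
    rw [𝓟.atiyahTrivializations.pretriv_apply (b y) (show b z ∈ _ from hz.2)]
    rfl
  constructor
  · intro hf y hy
    have h1 := ((𝓟.atiyahTrivializations.contMDiffWithinAt_iff
      (f := fun y => (⟨b y, a y⟩ : TotalSpace FP 𝓟.Atiyah)) (s := S)).1 (hf y hy)).2
    have h2 : ContMDiffOn J 𝓘(ℝ, FP) ∞
        (fun z => (𝓟.atiyahTrivializations.pretriv (b y) ⟨b z, a z⟩).2)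
        (S ∩ b ⁻¹' 𝓟.sectionDomain (b y)) := by
      have he : trivializationAt FP 𝓟.Atiyah (b y) =
        𝓟.atiyahTrivializations.prebundle.trivializationOfMemPretrivializationAtlas
          ⟨b y, rfl⟩ := rfl
      have h3 := ((trivializationAt FP 𝓟.Atiyah (b y)).contMDiffOn_iff (IB := 𝓘(ℝ, FM)) (n := ∞)
        (f := fun y => (⟨b y, a y⟩ : TotalSpace FP 𝓟.Atiyah))
        (s := S ∩ b ⁻¹' 𝓟.sectionDomain (b y)) (fun z hz => hz.2)).1 (hf.mono inter_subset_left)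
      exact h3.2
    have h4 := contMDiffOn_tangentTriv_symm (𝓟.basePoint (b y)) (hsec y) h2 fun z hz => hz.2.2
    have h5 : ContMDiffOn J 𝓘(ℝ, FP).tangent ∞ (fun z => (⟨𝓟.localSection (b y) (b z),
      (a z).evalAt (𝓟.localSection (b y) (b z))⟩ : TangentBundle 𝓘(ℝ, FP) P))
      (S ∩ b ⁻¹' 𝓟.sectionDomain (b y)) := by
      refine h4.congr fun z hz => ?_
      rw [hcoord y z hz, ← 𝓟.evalAt_atiyahCoord_symm hz.2, ContinuousLinearEquiv.symm_apply_apply]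
    have h6 := contMDiffOn_evalAt_of_lift (hsec y) (hζ.mono inter_subset_left)
      (fun z hz => 𝓟.proj_localSection hz.2) (fun z hz => h z hz.1) h5
    exact (h6.contMDiffAt ((hopen y hy).mem_nhds (hmem y hy))).contMDiffWithinAt
  · intro hf y hy
    refine (𝓟.atiyahTrivializations.contMDiffWithinAt_iff
      (f := fun y => (⟨b y, a y⟩ : TotalSpace FP 𝓟.Atiyah)) (s := S)).2 ⟨hb y hy, ?_⟩
    have h5 := contMDiffOn_evalAt_of_lift (hζ.mono inter_subset_left) (hsec y)
      (fun z hz => h z hz.1) (fun z hz => 𝓟.proj_localSection hz.2) (hf.mono inter_subset_left)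
    exact ((𝓟.contMDiffOn_atiyahCoord (b y) (fun z hz => hz.2) h5 (hcoord y)).contMDiffAt
      ((hopen y hy).mem_nhds (hmem y hy))).contMDiffWithinAt

/-- The projection `At(P) → TM` induced by the differential of `P → M`. -/
def eta (x : M) : 𝓟.Atiyah x →L[ℝ] TangentSpace 𝓘(ℝ, FM) x :=
  (show TangentSpace 𝓘(ℝ, FP) (𝓟.basePoint x) →L[ℝ] TangentSpace 𝓘(ℝ, FM) x from
    mfderiv 𝓘(ℝ, FP) 𝓘(ℝ, FM) 𝓟.proj (𝓟.basePoint x)).comp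
    (𝓟.evalEquiv ⟨𝓟.basePoint x, 𝓟.proj_basePoint x⟩ : 𝓟.Atiyah x →L[ℝ] _)

variable {𝓟} in
/-- The projection `At(P) → TM` can be computed at any point of the fibre. -/
theorem eta_apply {x : M} (a : 𝓟.Atiyah x) (z : 𝓟.Fiber x) :
    𝓟.eta x a = mfderiv 𝓘(ℝ, FP) 𝓘(ℝ, FM) 𝓟.proj z.1 (a.eval z) := by
  let z₀ : 𝓟.Fiber x := ⟨𝓟.basePoint x, 𝓟.proj_basePoint x⟩
  obtain ⟨g, hg⟩ : ∃ g, z₀.act g = z := ⟨𝓟.div z₀.1 z.1, Subtype.ext (𝓟.act_div (z₀.2.trans z.2.symm))⟩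
  subst hg
  rw [a.eval_act]
  have h := mfderiv_comp z₀.1 (𝓟.mdifferentiableAt_proj (𝓟.act z₀.1 g))
    (𝓟.mdifferentiableAt_actRight g z₀.1)
  have h2 : 𝓟.proj ∘ (fun y => 𝓟.act y g) = 𝓟.proj := funext fun y => 𝓟.proj_act y g
  rw [h2] at h
  exact DFunLike.congr_fun h (a.eval z₀)

end PrincipalBundle

theorem exists_splitting {V W : Type*} [NormedAddCommGroup V] [NormedSpace ℝ V]
    [FiniteDimensional ℝ V] [NormedAddCommGroup W] [NormedSpace ℝ W] [FiniteDimensional ℝ W]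
    (L : V →L[ℝ] W) (hL : Function.Surjective L) :
    ∃ q : V →L[ℝ] EuclideanSpace ℝ (Fin (Module.finrank ℝ V - Module.finrank ℝ W)),
      ∃ Λ : V ≃L[ℝ] W × EuclideanSpace ℝ (Fin (Module.finrank ℝ V - Module.finrank ℝ W)),
        (Λ : V →L[ℝ] _) = L.prod q := by
  have hr := L.toLinearMap.finrank_range_add_finrank_ker
  have h1 : Module.finrank ℝ (LinearMap.range L.toLinearMap) = Module.finrank ℝ W := by
    rw [LinearMap.range_eq_top.2 hL, finrank_top]
  have hk : Module.finrank ℝ (LinearMap.ker L.toLinearMap) =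
      Module.finrank ℝ (EuclideanSpace ℝ (Fin (Module.finrank ℝ V - Module.finrank ℝ W))) := by
    rw [finrank_euclideanSpace_fin]
    omega
  obtain ⟨p, hp⟩ := (LinearMap.ker L.toLinearMap).subtype.exists_leftInverse_of_injective
    (LinearMap.ker_eq_bot.2 Subtype.val_injective)
  let e := LinearEquiv.ofFinrankEq _ _ hk
  let q := LinearMap.toContinuousLinearMap (e.toLinearMap.comp p)
  have hinj : Function.Injective (L.prod q).toLinearMap := by
    rw [← LinearMap.ker_eq_bot, LinearMap.ker_eq_bot']
    intro v hv
    have hv1 : L v = 0 := congrArg Prod.fst hv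
    have hv2 : e (p v) = 0 := congrArg Prod.snd hv
    have hv3 : p v = 0 := by simpa using hv2
    have hv4 : p v = ⟨v, hv1⟩ := DFunLike.congr_fun hp ⟨v, hv1⟩
    rw [hv4] at hv3
    exact congrArg Subtype.val hv3
  have hdim : Module.finrank ℝ V = Module.finrank ℝ
      (W × EuclideanSpace ℝ (Fin (Module.finrank ℝ V - Module.finrank ℝ W))) := by
    rw [Module.finrank_prod, finrank_euclideanSpace_fin]
    omega
  refine ⟨q, (LinearEquiv.ofInjectiveOfFinrankEq _ hinj hdim).toContinuousLinearEquiv, ?_⟩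
  ext v <;> rfl

namespace PrincipalBundle

variable {FG : Type*} [NormedAddCommGroup FG] [NormedSpace ℝ FG]
    {G : Type*} [TopologicalSpace G] [ChartedSpace FG G] [Group G] [LieGroup 𝓘(ℝ, FG) ∞ G]
    {FM : Type*} [NormedAddCommGroup FM] [NormedSpace ℝ FM] [FiniteDimensional ℝ FM]
    {M : Type*} [TopologicalSpace M] [ChartedSpace FM M] [IsManifold 𝓘(ℝ, FM) ∞ M]
    {FP : Type*} [NormedAddCommGroup FP] [NormedSpace ℝ FP] [FiniteDimensional ℝ FP]
    {P : Type*} [TopologicalSpace P] [ChartedSpace FP P] [IsManifold 𝓘(ℝ, FP) ∞ P]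
    (𝓟 : PrincipalBundle FG G FM M FP P)
    {EY HY Y : Type*} [NormedAddCommGroup EY] [NormedSpace ℝ EY] [TopologicalSpace HY]
    {J : ModelWithCorners ℝ EY HY} [TopologicalSpace Y] [ChartedSpace HY Y]

variable {𝓟} in
theorem contMDiffOn_eta {b : Y → M} {a : ∀ y, 𝓟.Atiyah (b y)} {S : Set Y} (hS : IsOpen S)
    (ha : ContMDiffOn J (𝓘(ℝ, FM).prod 𝓘(ℝ, FP)) ∞
      (fun y => (⟨b y, a y⟩ : TotalSpace FP 𝓟.Atiyah)) S) :
    ContMDiffOn J 𝓘(ℝ, FM).tangent ∞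
      (fun y => (⟨b y, 𝓟.eta (b y) (a y)⟩ : TangentBundle 𝓘(ℝ, FM) M)) S := by
  have hb : ContMDiffOn J 𝓘(ℝ, FM) ∞ b S :=
    (Bundle.contMDiff_proj (IB := 𝓘(ℝ, FM)) (n := ∞) (F := FP) 𝓟.Atiyah).comp_contMDiffOn ha
  intro y hy
  let T := S ∩ b ⁻¹' 𝓟.sectionDomain (b y)
  have hT : IsOpen T := hb.continuousOn.isOpen_inter_preimage hS (𝓟.isOpen_sectionDomain _)
  have hyT : y ∈ T := ⟨hy, 𝓟.mem_sectionDomain _⟩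
  have h1 := (contMDiffOn_atiyah_iff hT
    ((𝓟.contMDiffOn_localSection (b y)).comp (hb.mono inter_subset_left) fun z hz => hz.2)
    (fun z hz => 𝓟.proj_localSection hz.2)).1 (ha.mono (inter_subset_left (s := S)))
  have h2 := contMDiffOn_mfderiv_comp 𝓟.contMDiff_proj.contMDiffOn isOpen_univ h1
    (fun _ _ => trivial)
  refine ((h2.congr fun z hz => ?_).contMDiffAt (hT.mem_nhds hyT)).contMDiffWithinAt
  have hz' : 𝓟.proj (𝓟.localSection (b y) (b z)) = b z := 𝓟.proj_localSection hz.2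
  rw [eta_apply (a z) ⟨_, hz'⟩, ← (a z).evalAt_eq hz']
  change (TotalSpace.mk (b z) _ : TangentBundle 𝓘(ℝ, FM) M) = TotalSpace.mk _ _
  congr 1
  exact hz'.symm

theorem surjective_mfderiv_proj (z : P) :
    Function.Surjective (mfderiv 𝓘(ℝ, FP) 𝓘(ℝ, FM) 𝓟.proj z) := by
  obtain ⟨s, U, hU, hzU, hs, hps, hsm⟩ := 𝓟.exists_localSection z
  have hsd : MDifferentiableAt 𝓘(ℝ, FM) 𝓘(ℝ, FP) s (𝓟.proj z) :=
    (hsm.contMDiffAt (hU.mem_nhds hzU)).mdifferentiableAt (by simp)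
  have h := mfderiv_comp (𝓟.proj z) (𝓟.mdifferentiableAt_proj (s (𝓟.proj z))) hsd
  have h2 : 𝓟.proj ∘ s =ᶠ[𝓝 (𝓟.proj z)] id := by
    filter_upwards [hU.mem_nhds hzU] with x hx using hps x hx
  rw [h2.mfderiv_eq, mfderiv_id, hs] at h
  intro v
  exact ⟨mfderiv 𝓘(ℝ, FM) 𝓘(ℝ, FP) s (𝓟.proj z) v, (DFunLike.congr_fun h v).symm⟩

theorem surjective_eta (x : M) : Function.Surjective (𝓟.eta x) := by
  intro v
  let z : 𝓟.Fiber x := ⟨𝓟.basePoint x, 𝓟.proj_basePoint x⟩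
  obtain ⟨w, hw⟩ := 𝓟.surjective_mfderiv_proj z.1 v
  refine ⟨(𝓟.evalEquiv z).symm w, ?_⟩
  rw [eta_apply _ z, ← hw]
  exact congrArg _ ((𝓟.evalEquiv z).apply_symm_apply w)

/-! ### The bundle of connections -/

/-- The total space of the vector bundle `At(P) ⊗ T*M = Hom(TM, At(P))`. -/
abbrev HomBundle : Type _ :=
  TotalSpace (FM →L[ℝ] FP) (fun x : M => TangentSpace 𝓘(ℝ, FM) x →L[ℝ] 𝓟.Atiyah x)

/-- The preimage of the identity section of `End(TM)` under the map
`Hom(TM, At(P)) → End(TM)` induced by `At(P) → TM`. -/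
def connectionSet : Set 𝓟.HomBundle :=
  {w | (𝓟.eta w.1).comp w.2 = ContinuousLinearMap.id ℝ (TangentSpace 𝓘(ℝ, FM) w.1)}

/-- The fibre bundle `𝒞(P)` of connections. -/
def ConnectionBundle : Type _ := 𝓟.connectionSet

/-- The preferred local trivialization of `At(P)` at `x₀`. -/
abbrev atTriv (x₀ : M) : Trivialization FP (π FP 𝓟.Atiyah) := trivializationAt FP 𝓟.Atiyah x₀

/-- The map `At(P) → TM` in the local trivializations at `x₀`. -/
def etaCoord (x₀ x : M) : FP →L[ℝ] FM :=
  ((tangentTriv FM x₀).continuousLinearMapAt ℝ x).comp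
    ((𝓟.eta x).comp ((𝓟.atTriv x₀).symmL ℝ x))

/-- The set over which `TM` and `At(P)` are trivialized at `x₀`. -/
def coordDomain (x₀ : M) : Set M := (tangentTriv FM x₀).baseSet ∩ (𝓟.atTriv x₀).baseSet

theorem isOpen_coordDomain (x₀ : M) : IsOpen (𝓟.coordDomain x₀) :=
  (tangentTriv FM x₀).open_baseSet.inter (𝓟.atTriv x₀).open_baseSet

theorem mem_coordDomain (x₀ : M) : x₀ ∈ 𝓟.coordDomain x₀ :=
  ⟨mem_baseSet_trivializationAt _ _ _, mem_baseSet_trivializationAt _ _ _⟩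

theorem contMDiffOn_etaCoord (x₀ : M) :
    ContMDiffOn 𝓘(ℝ, FM) 𝓘(ℝ, FP →L[ℝ] FM) ∞ (𝓟.etaCoord x₀) (𝓟.coordDomain x₀) := by
  intro x hx
  refine contMDiffWithinAt_clm_of_apply fun v => ?_
  have h1 : ContMDiffOn 𝓘(ℝ, FM) (𝓘(ℝ, FM).prod 𝓘(ℝ, FP)) ∞
      (fun y => (⟨y, (𝓟.atTriv x₀).symmL ℝ y v⟩ : TotalSpace FP 𝓟.Atiyah))
      (𝓟.coordDomain x₀) := by
    have h := ((𝓟.atTriv x₀).contMDiffOn_symm (IB := 𝓘(ℝ, FM)) (n := ∞)).comp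
      (contMDiffOn_id.prodMk (contMDiffOn_const (c := v)))
      (fun y (hy : y ∈ 𝓟.coordDomain x₀) => (𝓟.atTriv x₀).mem_target.2 hy.2)
    refine h.congr fun y hy => ?_
    rw [Trivialization.symmL_apply _ hy.2]
    exact (𝓟.atTriv x₀).mk_symm hy.2 v
  exact contMDiffOn_tangentTriv x₀ (contMDiffOn_eta (𝓟.isOpen_coordDomain x₀) h1)
    (fun y hy => hy.1) x hx

theorem surjective_etaCoord (x₀ : M) : Function.Surjective (𝓟.etaCoord x₀ x₀) := by
  intro v
  have h1 : x₀ ∈ (tangentTriv FM x₀).baseSet := (𝓟.mem_coordDomain x₀).1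
  have h2 : x₀ ∈ (𝓟.atTriv x₀).baseSet := (𝓟.mem_coordDomain x₀).2
  obtain ⟨a, ha⟩ := 𝓟.surjective_eta x₀ ((tangentTriv FM x₀).symmL ℝ x₀ v)
  refine ⟨(𝓟.atTriv x₀).continuousLinearMapAt ℝ x₀ a, ?_⟩
  simp only [etaCoord, ContinuousLinearMap.comp_apply]
  rw [Trivialization.symmL_continuousLinearMapAt _ h2, ha,
    Trivialization.continuousLinearMapAt_symmL _ h1]

variable (FM FP) in
/-- The model for the vertical vectors: its dimension is the dimension of the fibres of `P → M`. -/
abbrev VerticalModel : Type := EuclideanSpace ℝ (Fin (Module.finrank ℝ FP - Module.finrank ℝ FM))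

/-- An auxiliary complement to `etaCoord` at `x₀`. -/
def complCoord (x₀ : M) : FP →L[ℝ] VerticalModel FM FP :=
  (exists_splitting _ (𝓟.surjective_etaCoord x₀)).choose

/-- The map `At(P) → TM`, in local trivializations, completed by a map to the vertical model. -/
def splitCoord (x₀ x : M) : FP →L[ℝ] FM × VerticalModel FM FP :=
  (𝓟.etaCoord x₀ x).prod (𝓟.complCoord x₀)

/-- The open set on which `splitCoord` is invertible. -/
def splitDomain (x₀ : M) : Set M :=
  𝓟.coordDomain x₀ ∩ 𝓟.splitCoord x₀ ⁻¹'
    range ((↑) : (FP ≃L[ℝ] FM × VerticalModel FM FP) → _)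

theorem contMDiffOn_splitCoord (x₀ : M) :
    ContMDiffOn 𝓘(ℝ, FM) 𝓘(ℝ, FP →L[ℝ] FM × VerticalModel FM FP) ∞ (𝓟.splitCoord x₀)
      (𝓟.coordDomain x₀) := by
  intro x hx
  refine contMDiffWithinAt_clm_of_apply fun v => ?_
  have h := (𝓟.contMDiffOn_etaCoord x₀).clm_apply (contMDiffOn_const (c := v))
  exact (h.prodMk_space contMDiffOn_const) x hx

theorem isOpen_splitDomain (x₀ : M) : IsOpen (𝓟.splitDomain x₀) :=
  haveI : CompleteSpace FP := FiniteDimensional.complete ℝ FP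
  (𝓟.contMDiffOn_splitCoord x₀).continuousOn.isOpen_inter_preimage (𝓟.isOpen_coordDomain x₀)
    ContinuousLinearEquiv.isOpen

theorem mem_splitDomain (x₀ : M) : x₀ ∈ 𝓟.splitDomain x₀ := by
  refine ⟨𝓟.mem_coordDomain x₀, ?_⟩
  obtain ⟨Λ, hΛ⟩ := (exists_splitting _ (𝓟.surjective_etaCoord x₀)).choose_spec
  exact ⟨Λ, hΛ⟩

/-- The connection with vertical coordinates `A`, in the local trivializations at `x₀`. -/
def connCoord (x₀ x : M) (A : FM →L[ℝ] VerticalModel FM FP) : FM →L[ℝ] FP :=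
  (ContinuousLinearMap.inverse (𝓟.splitCoord x₀ x)).comp
    ((ContinuousLinearMap.id ℝ FM).prod A)

theorem splitCoord_comp_connCoord {x₀ x : M} (hx : x ∈ 𝓟.splitDomain x₀)
    (A : FM →L[ℝ] VerticalModel FM FP) :
    (𝓟.splitCoord x₀ x).comp (𝓟.connCoord x₀ x A) = (ContinuousLinearMap.id ℝ FM).prod A := by
  obtain ⟨Λ, hΛ⟩ := hx.2
  rw [connCoord, ← hΛ, ContinuousLinearMap.inverse_equiv, ← ContinuousLinearMap.comp_assoc]
  simp

theorem connCoord_eq {x₀ x : M} (hx : x ∈ 𝓟.splitDomain x₀) {H : FM →L[ℝ] FP}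
    (hH : (𝓟.etaCoord x₀ x).comp H = ContinuousLinearMap.id ℝ FM) :
    𝓟.connCoord x₀ x ((𝓟.complCoord x₀).comp H) = H := by
  obtain ⟨Λ, hΛ⟩ := hx.2
  have h : (ContinuousLinearMap.id ℝ FM).prod ((𝓟.complCoord x₀).comp H) =
      (Λ : FP →L[ℝ] _).comp H := by
    rw [hΛ, ← hH]
    rfl
  rw [connCoord, ← hΛ, ContinuousLinearMap.inverse_equiv, h, ← ContinuousLinearMap.comp_assoc]
  simp

/-- The preferred local trivialization of `Hom(TM, At(P))` at `x₀`. -/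
abbrev homTriv (x₀ : M) : Trivialization (FM →L[ℝ] FP) (π (FM →L[ℝ] FP)
    (fun x : M => TangentSpace 𝓘(ℝ, FM) x →L[ℝ] 𝓟.Atiyah x)) :=
  trivializationAt (FM →L[ℝ] FP) (fun x : M => TangentSpace 𝓘(ℝ, FM) x →L[ℝ] 𝓟.Atiyah x) x₀

theorem homTriv_baseSet (x₀ : M) : (𝓟.homTriv x₀).baseSet = 𝓟.coordDomain x₀ := rfl

theorem homTriv_apply (x₀ : M) (w : 𝓟.HomBundle) :
    (𝓟.homTriv x₀ w).2 = ((𝓟.atTriv x₀).continuousLinearMapAt ℝ w.1).comp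
      (w.2.comp ((tangentTriv FM x₀).symmL ℝ w.1)) := rfl

theorem etaCoord_comp_homTriv {x₀ : M} {w : 𝓟.HomBundle} (hw : w.1 ∈ 𝓟.coordDomain x₀) :
    (𝓟.etaCoord x₀ w.1).comp (𝓟.homTriv x₀ w).2 = ((tangentTriv FM x₀).continuousLinearMapAt ℝ w.1).comp
      (((𝓟.eta w.1).comp w.2).comp ((tangentTriv FM x₀).symmL ℝ w.1)) := by
  rw [homTriv_apply]
  ext v
  simp only [etaCoord, ContinuousLinearMap.comp_apply]
  rw [Trivialization.symmL_continuousLinearMapAt _ hw.2]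

theorem mem_connectionSet_iff {x₀ : M} {w : 𝓟.HomBundle} (hw : w.1 ∈ 𝓟.coordDomain x₀) :
    w ∈ 𝓟.connectionSet ↔
      (𝓟.etaCoord x₀ w.1).comp (𝓟.homTriv x₀ w).2 = ContinuousLinearMap.id ℝ FM := by
  rw [etaCoord_comp_homTriv 𝓟 hw]
  constructor
  · intro h
    have h : (𝓟.eta w.1).comp w.2 = ContinuousLinearMap.id ℝ (TangentSpace 𝓘(ℝ, FM) w.1) := h
    rw [h]
    ext v
    simp [Trivialization.continuousLinearMapAt_symmL _ hw.1]
  · intro h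
    change (𝓟.eta w.1).comp w.2 = ContinuousLinearMap.id ℝ (TangentSpace 𝓘(ℝ, FM) w.1)
    ext v
    have h1 := DFunLike.congr_fun h ((tangentTriv FM x₀).continuousLinearMapAt ℝ w.1 v)
    simp only [ContinuousLinearMap.comp_apply] at h1
    rw [Trivialization.symmL_continuousLinearMapAt _ hw.1] at h1
    have h2 := congrArg ((tangentTriv FM x₀).symmL ℝ w.1) h1
    rw [Trivialization.symmL_continuousLinearMapAt _ hw.1] at h2
    rw [ContinuousLinearMap.comp_apply, h2]
    exact Trivialization.symmL_continuousLinearMapAt _ hw.1 v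

/-- `𝒞(P)` is an embedded submanifold of `Hom(TM, At(P))`: near `c`, a splitting is determined by its
base point and its component in the vertical model. -/
def connectionSlice (c : 𝓟.connectionSet) :
    LocalSlice (𝓘(ℝ, FM).prod 𝓘(ℝ, FM →L[ℝ] FP)) (FM × (FM →L[ℝ] VerticalModel FM FP))
      𝓟.connectionSet c where
  source := {w | w.1 ∈ (chartAt FM c.1.1).source ∩ 𝓟.splitDomain c.1.1}
  target := {u | u.1 ∈ (chartAt FM c.1.1).target ∩
    (chartAt FM c.1.1).symm ⁻¹' 𝓟.splitDomain c.1.1}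
  toFun w := (chartAt FM c.1.1 w.1, (𝓟.complCoord c.1.1).comp (𝓟.homTriv c.1.1 w).2)
  invFun u := (𝓟.homTriv c.1.1).toOpenPartialHomeomorph.symm
    ((chartAt FM c.1.1).symm u.1, 𝓟.connCoord c.1.1 ((chartAt FM c.1.1).symm u.1) u.2)
  isOpen_source := ((chartAt FM c.1.1).open_source.inter (𝓟.isOpen_splitDomain _)).preimage
    (Bundle.contMDiff_proj (IB := 𝓘(ℝ, FM)) (n := ∞) _).continuous
  isOpen_target := ((chartAt FM c.1.1).symm.isOpen_inter_preimage
    (𝓟.isOpen_splitDomain c.1.1)).preimage continuous_fst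
  mem_source := ⟨mem_chart_source _ _, 𝓟.mem_splitDomain _⟩
  mapsTo w hw _ := ⟨(chartAt FM c.1.1).map_source hw.1, by
    rw [mem_preimage, (chartAt FM c.1.1).left_inv hw.1]
    exact hw.2⟩
  inv_mem_source u hu := by
    have h := (𝓟.homTriv c.1.1).proj_symm_apply (x := ((chartAt FM c.1.1).symm u.1,
      𝓟.connCoord c.1.1 ((chartAt FM c.1.1).symm u.1) u.2))
      ((𝓟.homTriv c.1.1).mem_target.2 hu.2.1)
    change TotalSpace.proj _ ∈ (chartAt FM c.1.1).source ∩ 𝓟.splitDomain c.1.1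
    rw [h]
    exact ⟨(chartAt FM c.1.1).map_target hu.1, hu.2⟩
  inv_mem u hu := by
    have ht := (𝓟.homTriv c.1.1).mem_target (x := ((chartAt FM c.1.1).symm u.1,
      𝓟.connCoord c.1.1 ((chartAt FM c.1.1).symm u.1) u.2)) |>.2 hu.2.1
    have h := (𝓟.homTriv c.1.1).proj_symm_apply ht
    have h' := (𝓟.homTriv c.1.1).apply_symm_apply ht
    rw [𝓟.mem_connectionSet_iff (x₀ := c.1.1) (by rw [h]; exact hu.2.1), h', h]
    have h2 := 𝓟.splitCoord_comp_connCoord hu.2 u.2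
    exact congrArg (ContinuousLinearMap.comp (ContinuousLinearMap.fst ℝ _ _)) h2
  left_inv w hw hwS := by
    simp only [(chartAt FM c.1.1).left_inv hw.1]
    rw [𝓟.connCoord_eq hw.2 ((𝓟.mem_connectionSet_iff hw.2.1).1 hwS)]
    exact (𝓟.homTriv c.1.1).symm_apply_mk_proj ((𝓟.homTriv c.1.1).mem_source.2 hw.2.1)
  right_inv u hu := by
    have ht := (𝓟.homTriv c.1.1).mem_target (x := ((chartAt FM c.1.1).symm u.1,
      𝓟.connCoord c.1.1 ((chartAt FM c.1.1).symm u.1) u.2)) |>.2 hu.2.1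
    have h := (𝓟.homTriv c.1.1).proj_symm_apply ht
    have h' := (𝓟.homTriv c.1.1).apply_symm_apply ht
    have h2 := 𝓟.splitCoord_comp_connCoord hu.2 u.2
    refine Prod.ext ?_ ?_
    · change chartAt FM c.1.1 (TotalSpace.proj _) = _
      rw [h]
      exact (chartAt FM c.1.1).right_inv hu.1
    · simp only [h']
      exact congrArg (ContinuousLinearMap.comp (ContinuousLinearMap.snd ℝ _ _)) h2
  contMDiffOn_toFun := by
    have hp := (Bundle.contMDiff_proj (IB := 𝓘(ℝ, FM)) (n := ∞) (F := FM →L[ℝ] FP)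
      (fun x : M => TangentSpace 𝓘(ℝ, FM) x →L[ℝ] 𝓟.Atiyah x))
    have h1 := (contMDiffOn_chart (I := 𝓘(ℝ, FM)) (n := ∞) (x := c.1.1)).comp
      hp.contMDiffOn (s := {w : 𝓟.HomBundle | w.1 ∈ (chartAt FM c.1.1).source ∩
        𝓟.splitDomain c.1.1}) (fun w hw => hw.1)
    have h2 : ContMDiffOn (𝓘(ℝ, FM).prod 𝓘(ℝ, FM →L[ℝ] FP)) 𝓘(ℝ, FM →L[ℝ] FP) ∞
        (fun w => (𝓟.homTriv c.1.1 w).2) {w : 𝓟.HomBundle | w.1 ∈ (chartAt FM c.1.1).source ∩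
        𝓟.splitDomain c.1.1} :=
      contMDiff_snd.comp_contMDiffOn
        (((𝓟.homTriv c.1.1).contMDiffOn (IB := 𝓘(ℝ, FM)) (n := ∞)).mono
          fun w hw => (𝓟.homTriv c.1.1).mem_source.2 hw.2.1)
    have h3 := (contMDiffOn_const (c := 𝓟.complCoord c.1.1)).clm_comp h2
    exact h1.prodMk_space h3
  contMDiffOn_invFun := by
    haveI : CompleteSpace FP := FiniteDimensional.complete ℝ FP
    have h1 : ContMDiffOn 𝓘(ℝ, FM × (FM →L[ℝ] VerticalModel FM FP)) 𝓘(ℝ, FM) ∞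
        (fun u : FM × (FM →L[ℝ] VerticalModel FM FP) => (chartAt FM c.1.1).symm u.1) {u | u.1 ∈ (chartAt FM c.1.1).target ∩
          (chartAt FM c.1.1).symm ⁻¹' 𝓟.splitDomain c.1.1} :=
      (contMDiffOn_chart_symm (I := 𝓘(ℝ, FM)) (n := ∞) (x := c.1.1)).comp
        contDiff_fst.contMDiff.contMDiffOn (fun u hu => hu.1)
    have h2 := (𝓟.contMDiffOn_splitCoord c.1.1).comp h1 (fun u hu => hu.2.1)
    have h3 : ContMDiffOn 𝓘(ℝ, FM × (FM →L[ℝ] VerticalModel FM FP))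
        𝓘(ℝ, (FM × VerticalModel FM FP) →L[ℝ] FP) ∞
        (fun u : FM × (FM →L[ℝ] VerticalModel FM FP) => ContinuousLinearMap.inverse
          (𝓟.splitCoord c.1.1 ((chartAt FM c.1.1).symm u.1)))
        {u : FM × (FM →L[ℝ] VerticalModel FM FP) | u.1 ∈ (chartAt FM c.1.1).target ∩
          (chartAt FM c.1.1).symm ⁻¹' 𝓟.splitDomain c.1.1} := by
      intro u hu
      obtain ⟨Λ, hΛ⟩ := hu.2.2
      have h := (contDiffAt_map_inverse (𝕜 := ℝ) (n := ∞) Λ).contMDiffAt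
      rw [hΛ] at h
      exact h.comp_contMDiffWithinAt u (h2 u hu)
    have h4 : ContMDiffOn 𝓘(ℝ, FM × (FM →L[ℝ] VerticalModel FM FP))
        𝓘(ℝ, FM →L[ℝ] FM × VerticalModel FM FP) ∞
        (fun u : FM × (FM →L[ℝ] VerticalModel FM FP) =>
          (ContinuousLinearMap.id ℝ FM).prod u.2) {u | u.1 ∈ (chartAt FM c.1.1).target ∩
          (chartAt FM c.1.1).symm ⁻¹' 𝓟.splitDomain c.1.1} := by
      intro u hu
      refine contMDiffWithinAt_clm_of_apply fun v => ?_
      refine ContMDiffAt.contMDiffWithinAt (ContDiffAt.contMDiffAt ?_)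
      refine ContDiffAt.prodMk contDiffAt_const ?_
      exact contDiffAt_snd.clm_apply contDiffAt_const
    exact ((𝓟.homTriv c.1.1).contMDiffOn_symm (IB := 𝓘(ℝ, FM)) (n := ∞)).comp
      (h1.prodMk (h3.clm_comp h4)) (fun u hu => (𝓟.homTriv c.1.1).mem_target.2 hu.2.1)

instance : TopologicalSpace 𝓟.ConnectionBundle :=
  instTopologicalSpaceSubtype (p := fun w => w ∈ 𝓟.connectionSet)

instance : ChartedSpace (FM × (FM →L[ℝ] VerticalModel FM FP)) 𝓟.ConnectionBundle :=
  LocalSlice.chartedSpace 𝓟.connectionSlice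

instance : IsManifold 𝓘(ℝ, FM × (FM →L[ℝ] VerticalModel FM FP)) ∞ 𝓟.ConnectionBundle :=
  LocalSlice.isManifold 𝓟.connectionSlice

end PrincipalBundle

namespace PrincipalBundle

variable {FG : Type*} [NormedAddCommGroup FG] [NormedSpace ℝ FG]
    {G : Type*} [TopologicalSpace G] [ChartedSpace FG G] [Group G] [LieGroup 𝓘(ℝ, FG) ∞ G]
    {FM : Type*} [NormedAddCommGroup FM] [NormedSpace ℝ FM]
    {M : Type*} [TopologicalSpace M] [ChartedSpace FM M] [IsManifold 𝓘(ℝ, FM) ∞ M]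
    {FP : Type*} [NormedAddCommGroup FP] [NormedSpace ℝ FP]
    {P : Type*} [TopologicalSpace P] [ChartedSpace FP P] [IsManifold 𝓘(ℝ, FP) ∞ P]
    (𝓟 : PrincipalBundle FG G FM M FP P)
    {FN : Type*} [NormedAddCommGroup FN] [NormedSpace ℝ FN]
    {N : Type*} [TopologicalSpace N] [ChartedSpace FN N] [IsManifold 𝓘(ℝ, FN) ∞ N]
    (f : C^∞⟮𝓘(ℝ, FN), N; 𝓘(ℝ, FM), M⟯)

/-! ### Pullback of principal bundles -/

/-- The fibre product `N ×_M P`, as a subset of `N × P`. -/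
def pullbackSet : Set (N × P) := {q | f q.1 = 𝓟.proj q.2}

/-- The total space of the pullback `f*P` of a principal bundle. -/
def Pullback : Type _ := 𝓟.pullbackSet f

theorem contMDiffOn_div_section {s : M → P} {U : Set M} (hps : ∀ x ∈ U, 𝓟.proj (s x) = x)
    (hs : ContMDiffOn 𝓘(ℝ, FM) 𝓘(ℝ, FP) ∞ s U) :
    ContMDiffOn 𝓘(ℝ, FP) 𝓘(ℝ, FG) ∞ (fun z => 𝓟.div (s (𝓟.proj z)) z) (𝓟.proj ⁻¹' U) :=
  𝓟.contMDiffOn_div.comp ((hs.comp 𝓟.contMDiff_proj.contMDiffOn (fun _ h => h)).prodMk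
    contMDiffOn_id) fun z hz => hps (𝓟.proj z) hz

/-- The slice of `N ×_M P` around `c` given by a local section `s` of `P → M`: the point `(n, s (f n) g)`
has the coordinates of `n` and `g`. -/
def pullbackSlice' (c : 𝓟.pullbackSet f) (s : M → P) (U : Set M) (hU : IsOpen U)
    (hcU : 𝓟.proj c.1.2 ∈ U) (hc : s (𝓟.proj c.1.2) = c.1.2) (hps : ∀ x ∈ U, 𝓟.proj (s x) = x)
    (hs : ContMDiffOn 𝓘(ℝ, FM) 𝓘(ℝ, FP) ∞ s U) :
    LocalSlice (𝓘(ℝ, FN).prod 𝓘(ℝ, FP)) (FN × FG) (𝓟.pullbackSet f) c where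
  source := ((chartAt FN c.1.1).source ∩ f ⁻¹' U) ×ˢ
    (𝓟.proj ⁻¹' U ∩ (fun z => 𝓟.div (s (𝓟.proj z)) z) ⁻¹' (chartAt FG (1 : G)).source)
  target := ((chartAt FN c.1.1).target ∩ (chartAt FN c.1.1).symm ⁻¹' (f ⁻¹' U)) ×ˢ
    (chartAt FG (1 : G)).target
  toFun q := (chartAt FN c.1.1 q.1, chartAt FG (1 : G) (𝓟.div (s (𝓟.proj q.2)) q.2))
  invFun u := ((chartAt FN c.1.1).symm u.1,
    𝓟.act (s (f ((chartAt FN c.1.1).symm u.1))) ((chartAt FG (1 : G)).symm u.2))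
  isOpen_source := by
    refine ((chartAt FN c.1.1).open_source.inter (hU.preimage f.contMDiff.continuous)).prod ?_
    exact (𝓟.contMDiffOn_div_section hps hs).continuousOn.isOpen_inter_preimage
      (hU.preimage 𝓟.contMDiff_proj.continuous) (chartAt FG (1 : G)).open_source
  isOpen_target := ((chartAt FN c.1.1).symm.isOpen_inter_preimage
    (hU.preimage f.contMDiff.continuous)).prod (chartAt FG (1 : G)).open_target
  mem_source := by
    refine ⟨⟨mem_chart_source _ _, ?_⟩, hcU, ?_⟩
    · change f c.1.1 ∈ U
      rw [show f c.1.1 = 𝓟.proj c.1.2 from c.2]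
      exact hcU
    · change 𝓟.div (s (𝓟.proj c.1.2)) c.1.2 ∈ (chartAt FG (1 : G)).source
      rw [hc, 𝓟.div_eq (𝓟.act_one _)]
      exact mem_chart_source _ _
  mapsTo q hq hqS := by
    refine ⟨⟨(chartAt FN c.1.1).map_source hq.1.1, ?_⟩, (chartAt FG (1 : G)).map_source hq.2.2⟩
    rw [mem_preimage, (chartAt FN c.1.1).left_inv hq.1.1]
    exact hq.1.2
  inv_mem_source u hu := by
    have h1 := hps _ hu.1.2
    refine ⟨⟨(chartAt FN c.1.1).map_target hu.1.1, hu.1.2⟩, ?_, ?_⟩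
    · rw [mem_preimage, 𝓟.proj_act, h1]
      exact hu.1.2
    · rw [mem_preimage, 𝓟.proj_act, h1, 𝓟.div_act]
      exact (chartAt FG (1 : G)).map_target hu.2
  inv_mem u hu := by
    have h1 := hps _ hu.1.2
    change f _ = 𝓟.proj (𝓟.act _ _)
    rw [𝓟.proj_act, h1]
  left_inv q hq hqS := by
    have hqS : f q.1 = 𝓟.proj q.2 := hqS
    refine Prod.ext ((chartAt FN c.1.1).left_inv hq.1.1) ?_
    simp only
    rw [(chartAt FN c.1.1).left_inv hq.1.1, (chartAt FG (1 : G)).left_inv hq.2.2, hqS,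
      𝓟.act_div (hps _ hq.2.1)]
  right_inv u hu := by
    have h1 := hps _ hu.1.2
    refine Prod.ext ((chartAt FN c.1.1).right_inv hu.1.1) ?_
    simp only
    rw [𝓟.proj_act, h1, 𝓟.div_act, (chartAt FG (1 : G)).right_inv hu.2]
  contMDiffOn_toFun := by
    have h1 : ContMDiffOn (𝓘(ℝ, FN).prod 𝓘(ℝ, FP)) 𝓘(ℝ, FN) ∞
        (fun q : N × P => chartAt FN c.1.1 q.1) (((chartAt FN c.1.1).source ∩ f ⁻¹' U) ×ˢ
    (𝓟.proj ⁻¹' U ∩ (fun z => 𝓟.div (s (𝓟.proj z)) z) ⁻¹' (chartAt FG (1 : G)).source)) :=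
      contMDiffOn_chart.comp contMDiffOn_fst fun q hq => hq.1.1
    have h2 : ContMDiffOn (𝓘(ℝ, FN).prod 𝓘(ℝ, FP)) 𝓘(ℝ, FG) ∞
        (fun q : N × P => chartAt FG (1 : G) (𝓟.div (s (𝓟.proj q.2)) q.2))
        (((chartAt FN c.1.1).source ∩ f ⁻¹' U) ×ˢ
    (𝓟.proj ⁻¹' U ∩ (fun z => 𝓟.div (s (𝓟.proj z)) z) ⁻¹' (chartAt FG (1 : G)).source)) :=
      contMDiffOn_chart.comp ((𝓟.contMDiffOn_div_section hps hs).comp contMDiffOn_snd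
        fun q hq => hq.2.1) fun q hq => hq.2.2
    exact h1.prodMk_space h2
  contMDiffOn_invFun := by
    have h1 : ContMDiffOn 𝓘(ℝ, FN × FG) 𝓘(ℝ, FN) ∞
        (fun u : FN × FG => (chartAt FN c.1.1).symm u.1)
        (((chartAt FN c.1.1).target ∩ (chartAt FN c.1.1).symm ⁻¹' (f ⁻¹' U)) ×ˢ
          (chartAt FG (1 : G)).target) :=
      contMDiffOn_chart_symm.comp contDiff_fst.contMDiff.contMDiffOn fun u hu => hu.1.1
    have h2 : ContMDiffOn 𝓘(ℝ, FN × FG) 𝓘(ℝ, FG) ∞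
        (fun u : FN × FG => (chartAt FG (1 : G)).symm u.2)
        (((chartAt FN c.1.1).target ∩ (chartAt FN c.1.1).symm ⁻¹' (f ⁻¹' U)) ×ˢ
          (chartAt FG (1 : G)).target) :=
      contMDiffOn_chart_symm.comp contDiff_snd.contMDiff.contMDiffOn fun u hu => hu.2
    have h3 := hs.comp (f.contMDiff.comp_contMDiffOn h1) fun u hu => hu.1.2
    exact h1.prodMk (𝓟.contMDiff_act.comp_contMDiffOn (h3.prodMk h2))

/-- `N ×_M P` is an embedded submanifold of `N × P`. -/
def pullbackSlice (c : 𝓟.pullbackSet f) :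
    LocalSlice (𝓘(ℝ, FN).prod 𝓘(ℝ, FP)) (FN × FG) (𝓟.pullbackSet f) c :=
  let h := 𝓟.exists_localSection c.1.2
  let h' := h.choose_spec.choose_spec
  𝓟.pullbackSlice' f c h.choose h.choose_spec.choose h'.1 h'.2.1 h'.2.2.1 h'.2.2.2.1 h'.2.2.2.2

instance : TopologicalSpace (𝓟.Pullback f) := inferInstanceAs (TopologicalSpace (𝓟.pullbackSet f))

instance : ChartedSpace (FN × FG) (𝓟.Pullback f) := LocalSlice.chartedSpace (𝓟.pullbackSlice f)

instance : IsManifold 𝓘(ℝ, FN × FG) ∞ (𝓟.Pullback f) := LocalSlice.isManifold (𝓟.pullbackSlice f)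

theorem contMDiff_pullback_coe :
    ContMDiff 𝓘(ℝ, FN × FG) (𝓘(ℝ, FN).prod 𝓘(ℝ, FP)) ∞ (fun q : 𝓟.Pullback f => q.1) :=
  LocalSlice.contMDiff_coe (𝓟.pullbackSlice f)

theorem contMDiff_pullback_fst : ContMDiff 𝓘(ℝ, FN × FG) 𝓘(ℝ, FN) ∞
    (fun q : 𝓟.Pullback f => q.1.1) := contMDiff_fst.comp (𝓟.contMDiff_pullback_coe f)

theorem contMDiff_pullback_snd : ContMDiff 𝓘(ℝ, FN × FG) 𝓘(ℝ, FP) ∞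
    (fun q : 𝓟.Pullback f => q.1.2) := contMDiff_snd.comp (𝓟.contMDiff_pullback_coe f)

/-- The pullback `f*P → N` of a principal bundle `P → M` along a smooth map `f : N → M`. -/
def pullback : PrincipalBundle FG G FN N (FN × FG) (𝓟.Pullback f) where
  proj q := q.1.1
  act q g := ⟨(q.1.1, 𝓟.act q.1.2 g), Eq.trans q.2 (𝓟.proj_act _ _).symm⟩
  contMDiff_proj := 𝓟.contMDiff_pullback_fst f
  surjective_proj n := by
    obtain ⟨z, hz⟩ := 𝓟.surjective_proj (f n)
    exact ⟨⟨(n, z), hz.symm⟩, rfl⟩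
  isSubmersion_proj := by
    refine Manifold.IsSubmersionOfComplement.isSubmersion (F := FG) fun q => ?_
    refine Manifold.IsSubmersionAtOfComplement.mk_of_charts (ContinuousLinearEquiv.refl ℝ (FN × FG))
      (chartAt (FN × FG) q) (chartAt FN q.1.1) (mem_chart_source _ _) (mem_chart_source _ _)
      (IsManifold.chart_mem_maximalAtlas q) (IsManifold.chart_mem_maximalAtlas _) ?_ ?_
    · intro q' hq'
      exact hq'.1.1
    · intro u hu
      have hu' : u ∈ (chartAt (FN × FG) q).target := by simpa using hu
      have hu : u ∈ (𝓟.pullbackSlice f q).target := hu'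
      have h := LocalSlice.coe_chart_symm (𝓟.pullbackSlice f q) hu
      change chartAt FN q.1.1 ((𝓟.pullbackSlice f q).chart.symm u).1.1 = u.1
      rw [h]
      exact (chartAt FN q.1.1).right_inv hu.1.1
  contMDiff_act := by
    intro p
    refine LocalSlice.contMDiffWithinAt_of_coe (𝓟.pullbackSlice f) ?_
    exact (((𝓟.contMDiff_pullback_fst f).comp contMDiff_fst).prodMk
      (𝓟.contMDiff_act.comp (((𝓟.contMDiff_pullback_snd f).comp contMDiff_fst).prodMk
        contMDiff_snd))) p
  act_one q := Subtype.ext (Prod.ext rfl (𝓟.act_one _))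
  act_mul q g h := Subtype.ext (Prod.ext rfl (𝓟.act_mul _ _ _))
  proj_act q g := rfl
  exists_div := by
    refine ⟨fun q q' => 𝓟.div q.1.2 q'.1.2, fun q g => 𝓟.div_act _ _, fun q q' h => ?_, ?_⟩
    · refine Subtype.ext (Prod.ext h (𝓟.act_div ?_))
      have h1 : f q.1.1 = 𝓟.proj q.1.2 := q.2
      have h2 : f q'.1.1 = 𝓟.proj q'.1.2 := q'.2
      have h : q.1.1 = q'.1.1 := h
      rw [← h1, ← h2, h]
    · refine 𝓟.contMDiffOn_div.comp
        (((𝓟.contMDiff_pullback_snd f).comp contMDiff_fst).prodMk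
          ((𝓟.contMDiff_pullback_snd f).comp contMDiff_snd)).contMDiffOn fun p hp => ?_
      have h1 : f p.1.1.1 = 𝓟.proj p.1.1.2 := p.1.2
      have h2 : f p.2.1.1 = 𝓟.proj p.2.1.2 := p.2.2
      have h : p.1.1.1 = p.2.1.1 := hp
      change 𝓟.proj p.1.1.2 = 𝓟.proj p.2.1.2
      rw [← h1, ← h2, h]

end PrincipalBundle

namespace PrincipalBundle

variable {FG : Type*} [NormedAddCommGroup FG] [NormedSpace ℝ FG]
    {G : Type*} [TopologicalSpace G] [ChartedSpace FG G] [Group G] [LieGroup 𝓘(ℝ, FG) ∞ G]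
    {FM : Type*} [NormedAddCommGroup FM] [NormedSpace ℝ FM]
    {M : Type*} [TopologicalSpace M] [ChartedSpace FM M] [IsManifold 𝓘(ℝ, FM) ∞ M]
    {FP : Type*} [NormedAddCommGroup FP] [NormedSpace ℝ FP]
    {P : Type*} [TopologicalSpace P] [ChartedSpace FP P] [IsManifold 𝓘(ℝ, FP) ∞ P]
    (𝓟 : PrincipalBundle FG G FM M FP P)
    {FN : Type*} [NormedAddCommGroup FN] [NormedSpace ℝ FN]
    {N : Type*} [TopologicalSpace N] [ChartedSpace FN N] [IsManifold 𝓘(ℝ, FN) ∞ N]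
    (f : C^∞⟮𝓘(ℝ, FN), N; 𝓘(ℝ, FM), M⟯)

/-! ### Tangent vectors of a pullback -/

theorem mfderiv_pullback_coe (q : 𝓟.Pullback f) (t : TangentSpace 𝓘(ℝ, FN × FG) q) :
    mfderiv 𝓘(ℝ, FN × FG) (𝓘(ℝ, FN).prod 𝓘(ℝ, FP)) (fun q : 𝓟.Pullback f => q.1) q t =
      (mfderiv 𝓘(ℝ, FN × FG) 𝓘(ℝ, FN) (fun q : 𝓟.Pullback f => q.1.1) q t,
       mfderiv 𝓘(ℝ, FN × FG) 𝓘(ℝ, FP) (fun q : 𝓟.Pullback f => q.1.2) q t) := by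
  have h := mfderiv_prodMk ((𝓟.contMDiff_pullback_fst f).mdifferentiable (by simp) q)
    ((𝓟.contMDiff_pullback_snd f).mdifferentiable (by simp) q)
  exact DFunLike.congr_fun h t

/-- A local retraction of `N × P` onto `f*P`. -/
def pullbackRetr (q : 𝓟.Pullback f) : N × P → 𝓟.Pullback f :=
  LocalSlice.retr (𝓟.pullbackSlice f q)

theorem mdifferentiableAt_pullbackRetr (q : 𝓟.Pullback f) :
    MDifferentiableAt (𝓘(ℝ, FN).prod 𝓘(ℝ, FP)) 𝓘(ℝ, FN × FG) (𝓟.pullbackRetr f q) q.1 := by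
  have h : ContMDiffOn (𝓘(ℝ, FN).prod 𝓘(ℝ, FP)) 𝓘(ℝ, FN × FG) ∞ (𝓟.pullbackRetr f q)
    (𝓟.pullbackSlice f q).retrSource := LocalSlice.contMDiffOn_retr (𝓟.pullbackSlice f) q
  exact (h.contMDiffAt ((𝓟.pullbackSlice f q).isOpen_retrSource.mem_nhds
    ((𝓟.pullbackSlice f q).mem_retrSource (𝓟.pullbackSlice f q).mem_source))).mdifferentiableAt
      (by simp)

theorem pullbackRetr_self (q : 𝓟.Pullback f) : 𝓟.pullbackRetr f q q.1 = q :=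
  LocalSlice.retr_coe (𝓟.pullbackSlice f q) (𝓟.pullbackSlice f q).mem_source

/-- The derivative at `q` of a local retraction of `N × P` onto `f*P`. -/
def liftTangent (q : 𝓟.Pullback f) :
    TangentSpace 𝓘(ℝ, FN) q.1.1 × TangentSpace 𝓘(ℝ, FP) q.1.2 →L[ℝ]
      TangentSpace 𝓘(ℝ, FN × FG) q :=
  mfderiv (𝓘(ℝ, FN).prod 𝓘(ℝ, FP)) 𝓘(ℝ, FN × FG)
    (𝓟.pullbackRetr f q) q.1

theorem liftTangent_mfderiv (q : 𝓟.Pullback f) (t : TangentSpace 𝓘(ℝ, FN × FG) q) :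
    𝓟.liftTangent f q (mfderiv 𝓘(ℝ, FN × FG) 𝓘(ℝ, FN) (fun q : 𝓟.Pullback f => q.1.1) q t,
       mfderiv 𝓘(ℝ, FN × FG) 𝓘(ℝ, FP) (fun q : 𝓟.Pullback f => q.1.2) q t) = t := by
  have h := LocalSlice.mfderiv_retr_coe (𝓟.pullbackSlice f) q (𝓟.pullbackSlice f q).mem_source t
  have h2 := 𝓟.mfderiv_pullback_coe f q t
  refine Eq.trans ?_ h
  exact congrArg (𝓟.liftTangent f q) h2.symm

theorem pullback_tangent_ext (q : 𝓟.Pullback f) {t t' : TangentSpace 𝓘(ℝ, FN × FG) q}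
    (h1 : mfderiv 𝓘(ℝ, FN × FG) 𝓘(ℝ, FN) (fun q : 𝓟.Pullback f => q.1.1) q t =
      mfderiv 𝓘(ℝ, FN × FG) 𝓘(ℝ, FN) (fun q : 𝓟.Pullback f => q.1.1) q t')
    (h2 : mfderiv 𝓘(ℝ, FN × FG) 𝓘(ℝ, FP) (fun q : 𝓟.Pullback f => q.1.2) q t =
      mfderiv 𝓘(ℝ, FN × FG) 𝓘(ℝ, FP) (fun q : 𝓟.Pullback f => q.1.2) q t') : t = t' := by
  rw [← 𝓟.liftTangent_mfderiv f q t, ← 𝓟.liftTangent_mfderiv f q t', h1, h2]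

theorem mfderiv_fst_liftTangent (q : 𝓟.Pullback f) (v : TangentSpace 𝓘(ℝ, FN) q.1.1)
    (w : TangentSpace 𝓘(ℝ, FP) q.1.2) :
    mfderiv 𝓘(ℝ, FN × FG) 𝓘(ℝ, FN) (fun q : 𝓟.Pullback f => q.1.1) q
      (𝓟.liftTangent f q (v, w)) = v := by
  let σ := 𝓟.pullbackSlice f q
  let ρ : N × P → 𝓟.Pullback f := 𝓟.pullbackRetr f q
  have hq : q.1 ∈ σ.retrSource := σ.mem_retrSource σ.mem_source
  have hρq : ρ q.1 = q := 𝓟.pullbackRetr_self f q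
  have hρ : MDifferentiableAt (𝓘(ℝ, FN).prod 𝓘(ℝ, FP)) 𝓘(ℝ, FN × FG) ρ q.1 :=
    𝓟.mdifferentiableAt_pullbackRetr f q
  have h1 : MDifferentiableAt 𝓘(ℝ, FN × FG) 𝓘(ℝ, FN) (fun q : 𝓟.Pullback f => q.1.1) (ρ q.1) :=
    (𝓟.contMDiff_pullback_fst f).mdifferentiable (by simp) _
  have h2 := mfderiv_comp q.1 h1 hρ
  have h3 : (fun q : 𝓟.Pullback f => q.1.1) ∘ ρ =ᶠ[𝓝 q.1] Prod.fst := by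
    filter_upwards [σ.isOpen_retrSource.mem_nhds hq] with w hw
    have h4 := σ.coe_retr hw
    change (σ.retr w).1.1 = w.1
    rw [h4]
    exact (chartAt FN q.1.1).left_inv hw.1.1.1
  rw [h3.mfderiv_eq, mfderiv_fst, hρq] at h2
  exact (DFunLike.congr_fun h2 (v, w)).symm

theorem mfderiv_snd_liftTangent (q : 𝓟.Pullback f) (v : TangentSpace 𝓘(ℝ, FN) q.1.1)
    (w : TangentSpace 𝓘(ℝ, FP) q.1.2)
    (hvw : (mfderiv 𝓘(ℝ, FN) 𝓘(ℝ, FM) f q.1.1 v : FM) =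
      mfderiv 𝓘(ℝ, FP) 𝓘(ℝ, FM) 𝓟.proj q.1.2 w) :
    mfderiv 𝓘(ℝ, FN × FG) 𝓘(ℝ, FP) (fun q : 𝓟.Pullback f => q.1.2) q
      (𝓟.liftTangent f q (v, w)) = w := by
  have hls := 𝓟.exists_localSection q.1.2
  let s : M → P := hls.choose
  let U : Set M := hls.choose_spec.choose
  have hU : IsOpen U := hls.choose_spec.choose_spec.1
  have hqU : 𝓟.proj q.1.2 ∈ U := hls.choose_spec.choose_spec.2.1
  have hps : ∀ x ∈ U, 𝓟.proj (s x) = x := hls.choose_spec.choose_spec.2.2.2.1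
  have hs : ContMDiffOn 𝓘(ℝ, FM) 𝓘(ℝ, FP) ∞ s U := hls.choose_spec.choose_spec.2.2.2.2
  let σ := 𝓟.pullbackSlice f q
  let ρ : N × P → 𝓟.Pullback f := 𝓟.pullbackRetr f q
  have hq : q.1 ∈ σ.retrSource := σ.mem_retrSource σ.mem_source
  have hρq : ρ q.1 = q := 𝓟.pullbackRetr_self f q
  have hρ : MDifferentiableAt (𝓘(ℝ, FN).prod 𝓘(ℝ, FP)) 𝓘(ℝ, FN × FG) ρ q.1 :=
    𝓟.mdifferentiableAt_pullbackRetr f q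
  have h1 : MDifferentiableAt 𝓘(ℝ, FN × FG) 𝓘(ℝ, FP) (fun q : 𝓟.Pullback f => q.1.2) (ρ q.1) :=
    (𝓟.contMDiff_pullback_snd f).mdifferentiable (by simp) _
  have h2 := mfderiv_comp q.1 h1 hρ
  -- the map `(x, g) ↦ s x * g`, and the fibre coordinate of the local trivialization
  let m : M × G → P := fun y => 𝓟.act (s y.1) y.2
  let κ : P → G := fun z => 𝓟.div (s (𝓟.proj z)) z
  let a : N × P → M × G := fun y => (f y.1, κ y.2)
  let b : P → M × G := fun z => (𝓟.proj z, κ z)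
  have hab : a q.1 = b q.1.2 := Prod.ext q.2 rfl
  have hκ : MDifferentiableAt 𝓘(ℝ, FP) 𝓘(ℝ, FG) κ q.1.2 :=
    ((𝓟.contMDiffOn_div_section hps hs).contMDiffAt
      ((hU.preimage 𝓟.contMDiff_proj.continuous).mem_nhds hqU)).mdifferentiableAt (by simp)
  have hm : MDifferentiableAt (𝓘(ℝ, FM).prod 𝓘(ℝ, FG)) 𝓘(ℝ, FP) m (b q.1.2) := by
    have : ContMDiffOn (𝓘(ℝ, FM).prod 𝓘(ℝ, FG)) 𝓘(ℝ, FP) ∞ m (U ×ˢ univ) :=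
      𝓟.contMDiff_act.comp_contMDiffOn ((hs.comp contMDiffOn_fst fun y hy => hy.1).prodMk
        contMDiffOn_snd)
    exact (this.contMDiffAt ((hU.prod isOpen_univ).mem_nhds ⟨hqU, trivial⟩)).mdifferentiableAt
      (by simp)
  have hf : MDifferentiableAt (𝓘(ℝ, FN).prod 𝓘(ℝ, FP)) 𝓘(ℝ, FM) (fun y : N × P => f y.1) q.1 :=
    (f.contMDiff.comp contMDiff_fst).mdifferentiable (by simp) _
  have hκ' : MDifferentiableAt (𝓘(ℝ, FN).prod 𝓘(ℝ, FP)) 𝓘(ℝ, FG) (fun y : N × P => κ y.2) q.1 :=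
    hκ.comp q.1 mdifferentiableAt_snd
  have h3 : (fun q : 𝓟.Pullback f => q.1.2) ∘ ρ =ᶠ[𝓝 q.1] m ∘ a := by
    filter_upwards [σ.isOpen_retrSource.mem_nhds hq] with y hy
    have h4 := σ.coe_retr hy
    change (σ.retr y).1.2 = 𝓟.act (s (f y.1)) (κ y.2)
    rw [h4]
    change 𝓟.act (s (f ((chartAt FN q.1.1).symm (chartAt FN q.1.1 y.1))))
      ((chartAt FG (1 : G)).symm (chartAt FG (1 : G) (κ y.2))) = _
    rw [(chartAt FN q.1.1).left_inv hy.1.1.1, (chartAt FG (1 : G)).left_inv hy.1.2.2]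
  have h5 : m ∘ b =ᶠ[𝓝 q.1.2] id := by
    filter_upwards [(hU.preimage 𝓟.contMDiff_proj.continuous).mem_nhds hqU] with z hz
    exact 𝓟.act_div (hps _ hz)
  have ha : MDifferentiableAt (𝓘(ℝ, FN).prod 𝓘(ℝ, FP)) (𝓘(ℝ, FM).prod 𝓘(ℝ, FG)) a q.1 :=
    hf.prodMk hκ'
  have hb : MDifferentiableAt 𝓘(ℝ, FP) (𝓘(ℝ, FM).prod 𝓘(ℝ, FG)) b q.1.2 :=
    (𝓟.mdifferentiableAt_proj _).prodMk hκ
  have h6 := mfderiv_comp q.1 (hab ▸ hm) ha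
  have h7 := mfderiv_comp q.1.2 hm hb
  rw [h5.mfderiv_eq, mfderiv_id] at h7
  rw [h3.mfderiv_eq, h6, hρq, hab] at h2
  have h8 : mfderiv (𝓘(ℝ, FN).prod 𝓘(ℝ, FP)) (𝓘(ℝ, FM).prod 𝓘(ℝ, FG)) a q.1 (v, w) =
      (mfderiv 𝓘(ℝ, FP) (𝓘(ℝ, FM).prod 𝓘(ℝ, FG)) b q.1.2 w : FM × FG) := by
    have e1 := mfderiv_prodMk hf hκ'
    have e2 := mfderiv_prodMk (𝓟.mdifferentiableAt_proj q.1.2) hκ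
    have e3 := mfderiv_comp q.1 ((f.contMDiff.mdifferentiable (by simp)) q.1.1)
      (mdifferentiableAt_fst (I := 𝓘(ℝ, FN)) (I' := 𝓘(ℝ, FP)) (x := q.1))
    have e4 := mfderiv_comp q.1 hκ
      (mdifferentiableAt_snd (I := 𝓘(ℝ, FN)) (I' := 𝓘(ℝ, FP)) (x := q.1))
    rw [mfderiv_fst] at e3
    rw [mfderiv_snd] at e4
    refine (DFunLike.congr_fun e1 (v, w)).trans (Eq.trans ?_ (DFunLike.congr_fun e2 w).symm)
    refine Prod.ext ?_ ?_
    · exact (DFunLike.congr_fun e3 (v, w)).trans hvw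
    · exact DFunLike.congr_fun e4 (v, w)
  have h9 := DFunLike.congr_fun h2 (v, w)
  refine h9.symm.trans ?_
  refine Eq.trans ?_ (DFunLike.congr_fun h7 w).symm
  exact congrArg (mfderiv (𝓘(ℝ, FM).prod 𝓘(ℝ, FG)) 𝓘(ℝ, FP) m (b q.1.2)) h8

/-! ### The Atiyah bundle of a pullback -/

variable {f} in
/-- The point `(n, z)` of `f*P`, for `z` in the fibre of `P` over `f n`. -/
def pullbackPoint {n : N} (z : 𝓟.Fiber (f n)) : (𝓟.pullback f).Fiber n :=
  ⟨⟨(n, z.1), z.2.symm⟩, rfl⟩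

theorem pullback_invariant {n : N} (a : (𝓟.pullback f).Atiyah n) :
    (fun z : 𝓟.Fiber (f n) => mfderiv 𝓘(ℝ, FN × FG) 𝓘(ℝ, FP) (fun q : 𝓟.Pullback f => q.1.2)
      (𝓟.pullbackPoint z).1 (a.eval (𝓟.pullbackPoint z))) ∈ 𝓟.invariantSections (f n) := by
  intro z g
  have h1 : a.eval (𝓟.pullbackPoint (z.act g)) = _ := a.eval_act (𝓟.pullbackPoint z) g
  have h3 := mfderiv_comp (𝓟.pullbackPoint z).1
    ((𝓟.contMDiff_pullback_snd f).mdifferentiable (by simp) _)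
    ((𝓟.pullback f).mdifferentiableAt_actRight g _)
  have h4 := mfderiv_comp (𝓟.pullbackPoint z).1
    (𝓟.mdifferentiableAt_actRight g z.1)
    ((𝓟.contMDiff_pullback_snd f).mdifferentiable (by simp) (𝓟.pullbackPoint z).1)
  have h5 : (fun q : 𝓟.Pullback f => q.1.2) ∘ (fun q => (𝓟.pullback f).act q g) =
    (fun z => 𝓟.act z g) ∘ (fun q : 𝓟.Pullback f => q.1.2) := rfl
  rw [h5] at h3
  have h6 := h3.symm.trans h4
  refine (congrArg (mfderiv 𝓘(ℝ, FN × FG) 𝓘(ℝ, FP) (fun q : 𝓟.Pullback f => q.1.2)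
    (𝓟.pullbackPoint (z.act g)).1) h1).trans ?_
  exact DFunLike.congr_fun h6 (a.eval (𝓟.pullbackPoint z))

/-- The natural projection `At(f*P) → f*At(P)`, induced by the differential of `f*P → P`. -/
def atiyahPullback (n : N) : (𝓟.pullback f).Atiyah n →L[ℝ] 𝓟.Atiyah (f n) where
  toFun a := ⟨_, 𝓟.pullback_invariant f a⟩
  map_add' _ _ := Subtype.ext (funext fun z => map_add (mfderiv 𝓘(ℝ, FN × FG) 𝓘(ℝ, FP)
    (fun q : 𝓟.Pullback f => q.1.2) (𝓟.pullbackPoint z).1) _ _)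
  map_smul' _ _ := Subtype.ext (funext fun z => map_smul (mfderiv 𝓘(ℝ, FN × FG) 𝓘(ℝ, FP)
    (fun q : 𝓟.Pullback f => q.1.2) (𝓟.pullbackPoint z).1) _ _)
  cont := Continuous.subtype_mk (continuous_pi fun z : 𝓟.Fiber (f n) =>
    (mfderiv 𝓘(ℝ, FN × FG) 𝓘(ℝ, FP) (fun q : 𝓟.Pullback f => q.1.2)
      (𝓟.pullbackPoint z).1).continuous.comp
        ((continuous_apply (𝓟.pullbackPoint z)).comp continuous_subtype_val)) _

theorem atiyahPullback_eval {n : N} (a : (𝓟.pullback f).Atiyah n) (z : 𝓟.Fiber (f n)) :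
    (𝓟.atiyahPullback f n a).eval z = mfderiv 𝓘(ℝ, FN × FG) 𝓘(ℝ, FP)
      (fun q : 𝓟.Pullback f => q.1.2) (𝓟.pullbackPoint z).1 (a.eval (𝓟.pullbackPoint z)) := rfl

variable [FiniteDimensional ℝ FP] [FiniteDimensional ℝ FN] [FiniteDimensional ℝ FG]

variable {𝓟 f} in
/-- An element of `At(f*P)` is determined by its images in `TN` and in `f*At(P)`. -/
theorem atiyahPullback_ext {n : N} {a a' : (𝓟.pullback f).Atiyah n}
    (h1 : (𝓟.pullback f).eta n a = (𝓟.pullback f).eta n a')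
    (h2 : 𝓟.atiyahPullback f n a = 𝓟.atiyahPullback f n a') : a = a' := by
  let z : 𝓟.Fiber (f n) := ⟨𝓟.basePoint (f n), 𝓟.proj_basePoint (f n)⟩
  refine ((𝓟.pullback f).evalEquiv (𝓟.pullbackPoint z)).injective ?_
  refine 𝓟.pullback_tangent_ext f _ ?_ ?_
  · rw [eta_apply a (𝓟.pullbackPoint z), eta_apply a' (𝓟.pullbackPoint z)] at h1
    exact h1
  · exact congrArg (fun b : 𝓟.Atiyah (f n) => b.eval z) h2

/-- The map `TN → At(f*P)` whose components in `TN` and `f*At(P)` are the identity and `L`. -/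
def lift (L : ∀ n : N, TangentSpace 𝓘(ℝ, FN) n →L[ℝ] 𝓟.Atiyah (f n)) (n : N) :
    TangentSpace 𝓘(ℝ, FN) n →L[ℝ] (𝓟.pullback f).Atiyah n :=
  let z : 𝓟.Fiber (f n) := ⟨𝓟.basePoint (f n), 𝓟.proj_basePoint (f n)⟩
  (((𝓟.pullback f).evalEquiv (𝓟.pullbackPoint z)).symm :
    TangentSpace 𝓘(ℝ, FN × FG) (𝓟.pullbackPoint z).1 →L[ℝ] _).comp
    ((𝓟.liftTangent f (𝓟.pullbackPoint z).1).comp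
      ((ContinuousLinearMap.id ℝ (TangentSpace 𝓘(ℝ, FN) n)).prod
        ((𝓟.evalEquiv z : 𝓟.Atiyah (f n) →L[ℝ] TangentSpace 𝓘(ℝ, FP) z.1).comp (L n))))

theorem eta_lift (L : ∀ n : N, TangentSpace 𝓘(ℝ, FN) n →L[ℝ] 𝓟.Atiyah (f n)) (n : N)
    (v : TangentSpace 𝓘(ℝ, FN) n) : (𝓟.pullback f).eta n (𝓟.lift f L n v) = v := by
  let z : 𝓟.Fiber (f n) := ⟨𝓟.basePoint (f n), 𝓟.proj_basePoint (f n)⟩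
  rw [eta_apply _ (𝓟.pullbackPoint z)]
  refine Eq.trans ?_ (𝓟.mfderiv_fst_liftTangent f (𝓟.pullbackPoint z).1 v ((L n v).eval z))
  exact congrArg _ (((𝓟.pullback f).evalEquiv (𝓟.pullbackPoint z)).apply_symm_apply _)

theorem atiyahPullback_lift {L : ∀ n : N, TangentSpace 𝓘(ℝ, FN) n →L[ℝ] 𝓟.Atiyah (f n)}
    (hL : ∀ n v, 𝓟.eta (f n) (L n v) = mfderiv 𝓘(ℝ, FN) 𝓘(ℝ, FM) f n v) (n : N)
    (v : TangentSpace 𝓘(ℝ, FN) n) : 𝓟.atiyahPullback f n (𝓟.lift f L n v) = L n v := by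
  let z : 𝓟.Fiber (f n) := ⟨𝓟.basePoint (f n), 𝓟.proj_basePoint (f n)⟩
  refine (𝓟.evalEquiv z).injective ?_
  have h := 𝓟.mfderiv_snd_liftTangent f (𝓟.pullbackPoint z).1 v ((L n v).eval z)
    ((hL n v).symm.trans (eta_apply (L n v) z))
  refine Eq.trans ?_ h
  exact congrArg (mfderiv 𝓘(ℝ, FN × FG) 𝓘(ℝ, FP)
      (fun q : 𝓟.Pullback f => q.1.2) (𝓟.pullbackPoint z).1)
    (((𝓟.pullback f).evalEquiv (𝓟.pullbackPoint z)).apply_symm_apply _)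

theorem contMDiff_lift {L : ∀ n : N, TangentSpace 𝓘(ℝ, FN) n →L[ℝ] 𝓟.Atiyah (f n)}
    (hL : ∀ n v, 𝓟.eta (f n) (L n v) = mfderiv 𝓘(ℝ, FN) 𝓘(ℝ, FM) f n v)
    (hLs : ContMDiff 𝓘(ℝ, FN).tangent (𝓘(ℝ, FM).prod 𝓘(ℝ, FP)) ∞
      (fun v : TangentBundle 𝓘(ℝ, FN) N => (⟨f v.1, L v.1 v.2⟩ : TotalSpace FP 𝓟.Atiyah))) :
    ContMDiff 𝓘(ℝ, FN).tangent (𝓘(ℝ, FN).prod 𝓘(ℝ, FN × FG)) ∞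
      (fun v : TangentBundle 𝓘(ℝ, FN) N =>
        (⟨v.1, 𝓟.lift f L v.1 v.2⟩ : TotalSpace (FN × FG) (𝓟.pullback f).Atiyah)) := by
  intro v₀
  have hπ : ContMDiff 𝓘(ℝ, FN).tangent 𝓘(ℝ, FN) ∞ (fun v : TangentBundle 𝓘(ℝ, FN) N => v.1) :=
    Bundle.contMDiff_proj (IB := 𝓘(ℝ, FN)) (n := ∞) (F := FN) (TangentSpace 𝓘(ℝ, FN) : N → Type _)
  let 𝓠 := 𝓟.pullback f
  let S : Set (TangentBundle 𝓘(ℝ, FN) N) := (fun v => v.1) ⁻¹' 𝓠.sectionDomain v₀.1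
  have hS : IsOpen S := (𝓠.isOpen_sectionDomain _).preimage hπ.continuous
  let ζ : TangentBundle 𝓘(ℝ, FN) N → 𝓟.Pullback f := fun v => 𝓠.localSection v₀.1 v.1
  have hζ : ContMDiffOn 𝓘(ℝ, FN).tangent 𝓘(ℝ, FN × FG) ∞ ζ S :=
    (𝓠.contMDiffOn_localSection v₀.1).comp hπ.contMDiffOn fun _ h => h
  have hζp : ∀ v ∈ S, (ζ v).1.1 = v.1 := fun v hv => 𝓠.proj_localSection hv
  have hζ2 : ContMDiffOn 𝓘(ℝ, FN).tangent 𝓘(ℝ, FP) ∞ (fun v => (ζ v).1.2) S :=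
    (𝓟.contMDiff_pullback_snd f).comp_contMDiffOn hζ
  have hζf : ∀ v ∈ S, 𝓟.proj (ζ v).1.2 = f v.1 := fun v hv => by
    rw [← hζp v hv]
    exact (ζ v).2.symm
  have h1 := (contMDiffOn_atiyah_iff hS hζ2 hζf).1 hLs.contMDiffOn
  have h2 := (contMDiff_equivTangentBundleProd_symm (n := ∞) (I := 𝓘(ℝ, FN)) (M := N)
    (I' := 𝓘(ℝ, FP)) (M' := P)).comp_contMDiffOn (contMDiffOn_id.prodMk h1)
  refine ((contMDiffOn_atiyah_iff hS hζ hζp).2 ?_).contMDiffAt (hS.mem_nhds ?_)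
  · refine LocalSlice.contMDiffOn_tangent_of_coe (𝓟.pullbackSlice f) hS (h2.congr ?_)
    intro v hv
    have e0 := 𝓟.mfderiv_pullback_coe f (ζ v) ((𝓟.lift f L v.1 v.2).evalAt (ζ v))
    have hv1 : (ζ v).1.1 = v.1 := hζp v hv
    have e1 : (mfderiv 𝓘(ℝ, FN × FG) 𝓘(ℝ, FN) (fun q : 𝓟.Pullback f => q.1.1) (ζ v)
        ((𝓟.lift f L v.1 v.2).evalAt (ζ v)) : FN) = v.2 := by
      rw [(𝓟.lift f L v.1 v.2).evalAt_eq hv1]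
      exact (eta_apply (𝓟.lift f L v.1 v.2) ⟨ζ v, hv1⟩).symm.trans (𝓟.eta_lift f L v.1 v.2)
    have e2 : mfderiv 𝓘(ℝ, FN × FG) 𝓘(ℝ, FP) (fun q : 𝓟.Pullback f => q.1.2) (ζ v)
        ((𝓟.lift f L v.1 v.2).evalAt (ζ v)) = (L v.1 v.2).evalAt (ζ v).1.2 := by
      rw [(𝓟.lift f L v.1 v.2).evalAt_eq hv1, (L v.1 v.2).evalAt_eq (hζf v hv),
        ← 𝓟.atiyahPullback_lift f hL v.1 v.2, atiyahPullback_eval]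
      have e3 : 𝓟.pullbackPoint ⟨(ζ v).1.2, hζf v hv⟩ = ⟨ζ v, hv1⟩ :=
        Subtype.ext (Subtype.ext (Prod.ext hv1.symm rfl))
      rw [e3]
    change (TotalSpace.mk (ζ v).1 _ : TangentBundle (𝓘(ℝ, FN).prod 𝓘(ℝ, FP)) (N × P)) =
      ⟨(v.1, (ζ v).1.2), (v.2, (L v.1 v.2).evalAt (ζ v).1.2)⟩
    have e5 : (ζ v).1 = (v.1, (ζ v).1.2) := Prod.ext hv1 rfl
    have e6 : (mfderiv 𝓘(ℝ, FN × FG) (𝓘(ℝ, FN).prod 𝓘(ℝ, FP)) (fun q : 𝓟.Pullback f => q.1) (ζ v)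
      ((𝓟.lift f L v.1 v.2).evalAt (ζ v)) : FN × FP) = (v.2, (L v.1 v.2).evalAt (ζ v).1.2) := by
      rw [e0]
      exact Prod.ext e1 e2
    change (TotalSpace.mk (ζ v).1 (mfderiv 𝓘(ℝ, FN × FG) (𝓘(ℝ, FN).prod 𝓘(ℝ, FP))
      (fun q : 𝓟.Pullback f => q.1) (ζ v) ((𝓟.lift f L v.1 v.2).evalAt (ζ v)) : FN × FP) :
      TangentBundle (𝓘(ℝ, FN).prod 𝓘(ℝ, FP)) (N × P)) = _
    rw [e6]
    exact congrArg (fun p : N × P => (TotalSpace.mk p ((v.2, (L v.1 v.2).evalAt (ζ v).1.2) : FN × FP) :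
      TangentBundle (𝓘(ℝ, FN).prod 𝓘(ℝ, FP)) (N × P))) e5
  · exact 𝓠.mem_sectionDomain v₀.1

end PrincipalBundle

/-! ### Connections -/

/-- A connection on `P → M`: a smooth splitting `TM → At(P)` of the Atiyah exact sequence. -/
@[ext]
structure Connection
    {FG : Type*} [NormedAddCommGroup FG] [NormedSpace ℝ FG]
    {G : Type*} [TopologicalSpace G] [ChartedSpace FG G] [Group G] [LieGroup 𝓘(ℝ, FG) ∞ G]
    {FM : Type*} [NormedAddCommGroup FM] [NormedSpace ℝ FM]
    {M : Type*} [TopologicalSpace M] [ChartedSpace FM M] [IsManifold 𝓘(ℝ, FM) ∞ M]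
    {FP : Type*} [NormedAddCommGroup FP] [NormedSpace ℝ FP] [FiniteDimensional ℝ FP]
    {P : Type*} [TopologicalSpace P] [ChartedSpace FP P] [IsManifold 𝓘(ℝ, FP) ∞ P]
    (𝓟 : PrincipalBundle FG G FM M FP P) where
  /-- the splitting -/
  toFun : ∀ x : M, TangentSpace 𝓘(ℝ, FM) x →L[ℝ] 𝓟.Atiyah x
  eta_comp : ∀ x, (𝓟.eta x).comp (toFun x) = ContinuousLinearMap.id ℝ (TangentSpace 𝓘(ℝ, FM) x)
  contMDiff : ContMDiff 𝓘(ℝ, FM).tangent (𝓘(ℝ, FM).prod 𝓘(ℝ, FP)) ∞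
    (fun v : TangentBundle 𝓘(ℝ, FM) M => (⟨v.1, toFun v.1 v.2⟩ : TotalSpace FP 𝓟.Atiyah))

/-- An isomorphism of principal `G`-bundles over the same base. -/
structure PrincipalBundle.Iso
    {FG : Type*} [NormedAddCommGroup FG] [NormedSpace ℝ FG]
    {G : Type*} [TopologicalSpace G] [ChartedSpace FG G] [Group G]
    {FM : Type*} [NormedAddCommGroup FM] [NormedSpace ℝ FM]
    {M : Type*} [TopologicalSpace M] [ChartedSpace FM M]
    {FP : Type*} [NormedAddCommGroup FP] [NormedSpace ℝ FP]
    {P : Type*} [TopologicalSpace P] [ChartedSpace FP P]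
    {FQ : Type*} [NormedAddCommGroup FQ] [NormedSpace ℝ FQ]
    {Q : Type*} [TopologicalSpace Q] [ChartedSpace FQ Q]
    (𝓟 : PrincipalBundle FG G FM M FP P) (𝓠 : PrincipalBundle FG G FM M FQ Q) where
  toFun : P → Q
  invFun : Q → P
  left_inv : ∀ z, invFun (toFun z) = z
  right_inv : ∀ w, toFun (invFun w) = w
  contMDiff_toFun : ContMDiff 𝓘(ℝ, FP) 𝓘(ℝ, FQ) ∞ toFun
  contMDiff_invFun : ContMDiff 𝓘(ℝ, FQ) 𝓘(ℝ, FP) ∞ invFun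
  proj_toFun : ∀ z, 𝓠.proj (toFun z) = 𝓟.proj z
  act_toFun : ∀ z g, 𝓠.act (toFun z) g = toFun (𝓟.act z g)

namespace PrincipalBundle

variable {FG : Type*} [NormedAddCommGroup FG] [NormedSpace ℝ FG] [FiniteDimensional ℝ FG]
    {G : Type*} [TopologicalSpace G] [ChartedSpace FG G] [Group G] [LieGroup 𝓘(ℝ, FG) ∞ G]
    {FM : Type*} [NormedAddCommGroup FM] [NormedSpace ℝ FM] [FiniteDimensional ℝ FM]
    {M : Type*} [TopologicalSpace M] [ChartedSpace FM M] [IsManifold 𝓘(ℝ, FM) ∞ M]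
    {FP : Type*} [NormedAddCommGroup FP] [NormedSpace ℝ FP] [FiniteDimensional ℝ FP]
    {P : Type*} [TopologicalSpace P] [ChartedSpace FP P] [IsManifold 𝓘(ℝ, FP) ∞ P]
    {FQ : Type*} [NormedAddCommGroup FQ] [NormedSpace ℝ FQ] [FiniteDimensional ℝ FQ]
    {Q : Type*} [TopologicalSpace Q] [ChartedSpace FQ Q] [IsManifold 𝓘(ℝ, FQ) ∞ Q]
    {FN : Type*} [NormedAddCommGroup FN] [NormedSpace ℝ FN] [FiniteDimensional ℝ FN]
    {N : Type*} [TopologicalSpace N] [ChartedSpace FN N] [IsManifold 𝓘(ℝ, FN) ∞ N]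
    {𝓟 : PrincipalBundle FG G FM M FP P} {𝓠 : PrincipalBundle FG G FM M FQ Q}

/-! #### Transport along an isomorphism -/

namespace Iso

variable (Φ : Iso 𝓟 𝓠)

theorem proj_invFun (w : Q) : 𝓟.proj (Φ.invFun w) = 𝓠.proj w := by
  rw [← Φ.proj_toFun, Φ.right_inv]

theorem act_invFun (w : Q) (g : G) : 𝓟.act (Φ.invFun w) g = Φ.invFun (𝓠.act w g) := by
  rw [← Φ.left_inv (𝓟.act (Φ.invFun w) g), ← Φ.act_toFun, Φ.right_inv]

/-- The inverse isomorphism, on fibres. -/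
def fiberInv {x : M} (w : 𝓠.Fiber x) : 𝓟.Fiber x := ⟨Φ.invFun w.1, (Φ.proj_invFun w.1).trans w.2⟩

theorem mdifferentiableAt (z : P) : MDifferentiableAt 𝓘(ℝ, FP) 𝓘(ℝ, FQ) Φ.toFun z :=
  Φ.contMDiff_toFun.mdifferentiable (by simp) z

theorem invariant {x : M} (a : 𝓟.Atiyah x) :
    (fun w : 𝓠.Fiber x => mfderiv 𝓘(ℝ, FP) 𝓘(ℝ, FQ) Φ.toFun (Φ.invFun w.1)
      (a.eval (Φ.fiberInv w))) ∈ 𝓠.invariantSections x := by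
  intro w g
  have h1 := a.eval_act (Φ.fiberInv w) g
  have h2 : (Φ.fiberInv w).act g = Φ.fiberInv (w.act g) := Subtype.ext (Φ.act_invFun w.1 g)
  have h3 := mfderiv_comp (Φ.invFun w.1) (Φ.mdifferentiableAt (𝓟.act (Φ.invFun w.1) g))
    (𝓟.mdifferentiableAt_actRight g (Φ.invFun w.1))
  have h4 := mfderiv_comp (Φ.invFun w.1) (𝓠.mdifferentiableAt_actRight g
    (Φ.toFun (Φ.invFun w.1))) (Φ.mdifferentiableAt (Φ.invFun w.1))
  have h5 : Φ.toFun ∘ (fun y => 𝓟.act y g) = (fun y => 𝓠.act y g) ∘ Φ.toFun :=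
    funext fun y => (Φ.act_toFun y g).symm
  rw [h5] at h3
  have h6 := h3.symm.trans h4
  have h7 : ∀ (z : 𝓟.Fiber x), z = (Φ.fiberInv w).act g →
      (mfderiv 𝓘(ℝ, FP) 𝓘(ℝ, FQ) Φ.toFun z.1 (a.eval z) : FQ) =
        mfderiv 𝓘(ℝ, FP) 𝓘(ℝ, FQ) Φ.toFun ((Φ.fiberInv w).act g).1
          (a.eval ((Φ.fiberInv w).act g)) := by
    rintro _ rfl
    rfl
  refine (h7 (Φ.fiberInv (w.act g)) h2.symm).trans ?_
  refine (congrArg (mfderiv 𝓘(ℝ, FP) 𝓘(ℝ, FQ) Φ.toFun ((Φ.fiberInv w).act g).1) h1).trans ?_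
  refine (DFunLike.congr_fun h6 (a.eval (Φ.fiberInv w))).trans ?_
  have h8 : Φ.toFun (Φ.invFun w.1) = w.1 := Φ.right_inv w.1
  rw [h8]
  rfl

/-- The map `At(P) → At(Q)` induced by the differential of an isomorphism `P ≅ Q`. -/
def atiyahMap (x : M) : 𝓟.Atiyah x →L[ℝ] 𝓠.Atiyah x where
  toFun a := ⟨_, Φ.invariant a⟩
  map_add' _ _ := Subtype.ext (funext fun w =>
    map_add (mfderiv 𝓘(ℝ, FP) 𝓘(ℝ, FQ) Φ.toFun (Φ.invFun w.1)) _ _)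
  map_smul' _ _ := Subtype.ext (funext fun w =>
    map_smul (mfderiv 𝓘(ℝ, FP) 𝓘(ℝ, FQ) Φ.toFun (Φ.invFun w.1)) _ _)
  cont := Continuous.subtype_mk (continuous_pi fun w : 𝓠.Fiber x =>
    (mfderiv 𝓘(ℝ, FP) 𝓘(ℝ, FQ) Φ.toFun (Φ.invFun w.1)).continuous.comp
      ((continuous_apply (Φ.fiberInv w)).comp continuous_subtype_val)) _

theorem eval_atiyahMap {x : M} (a : 𝓟.Atiyah x) (w : 𝓠.Fiber x) :
    (Φ.atiyahMap x a).eval w = (mfderiv 𝓘(ℝ, FP) 𝓘(ℝ, FQ) Φ.toFun (Φ.invFun w.1)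
      (a.eval (Φ.fiberInv w)) : FQ) := rfl

theorem eta_atiyahMap {x : M} (a : 𝓟.Atiyah x) : 𝓠.eta x (Φ.atiyahMap x a) = 𝓟.eta x a := by
  let w : 𝓠.Fiber x := ⟨𝓠.basePoint x, 𝓠.proj_basePoint x⟩
  rw [eta_apply _ w, eta_apply a (Φ.fiberInv w), eval_atiyahMap]
  have h := mfderiv_comp (Φ.invFun w.1) (𝓠.mdifferentiableAt_proj (Φ.toFun (Φ.invFun w.1)))
    (Φ.mdifferentiableAt (Φ.invFun w.1))
  have h2 : 𝓠.proj ∘ Φ.toFun = 𝓟.proj := funext Φ.proj_toFun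
  have h8 : Φ.toFun (Φ.invFun w.1) = w.1 := Φ.right_inv w.1
  rw [h2, h8] at h
  exact (DFunLike.congr_fun h (a.eval (Φ.fiberInv w))).symm

end Iso

/-- The connection on `Q` corresponding to a connection on `P` under an isomorphism `P ≅ Q`. -/
def _root_.Connection.transport (D : Connection 𝓟) (Φ : Iso 𝓟 𝓠) : Connection 𝓠 where
  toFun x := (Φ.atiyahMap x).comp (D.toFun x)
  eta_comp x := by
    ext v
    exact (Φ.eta_atiyahMap _).trans (DFunLike.congr_fun (D.eta_comp x) v)
  contMDiff := by
    intro v₀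
    have hπ : ContMDiff 𝓘(ℝ, FM).tangent 𝓘(ℝ, FM) ∞ (fun v : TangentBundle 𝓘(ℝ, FM) M => v.1) :=
      Bundle.contMDiff_proj (IB := 𝓘(ℝ, FM)) (n := ∞) (F := FM)
        (TangentSpace 𝓘(ℝ, FM) : M → Type _)
    let S : Set (TangentBundle 𝓘(ℝ, FM) M) := (fun v => v.1) ⁻¹' 𝓠.sectionDomain v₀.1
    have hS : IsOpen S := (𝓠.isOpen_sectionDomain _).preimage hπ.continuous
    have hζ : ContMDiffOn 𝓘(ℝ, FM).tangent 𝓘(ℝ, FQ) ∞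
        (fun v : TangentBundle 𝓘(ℝ, FM) M => 𝓠.localSection v₀.1 v.1) S :=
      (𝓠.contMDiffOn_localSection v₀.1).comp hπ.contMDiffOn fun _ h => h
    have hζp : ∀ v ∈ S, 𝓠.proj (𝓠.localSection v₀.1 v.1) = v.1 := fun v hv =>
      𝓠.proj_localSection hv
    have hζ' := Φ.contMDiff_invFun.comp_contMDiffOn hζ
    have hζp' : ∀ v ∈ S, 𝓟.proj (Φ.invFun (𝓠.localSection v₀.1 v.1)) = v.1 := fun v hv =>
      (Φ.proj_invFun _).trans (hζp v hv)
    refine ((contMDiffOn_atiyah_iff hS hζ hζp).2 ?_).contMDiffAt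
      (hS.mem_nhds (𝓠.mem_sectionDomain v₀.1))
    have h1 := (contMDiffOn_atiyah_iff hS hζ' hζp').1 D.contMDiff.contMDiffOn
    have h2 := contMDiffOn_mfderiv_comp Φ.contMDiff_toFun.contMDiffOn isOpen_univ h1
      (fun _ _ => trivial)
    refine h2.congr fun v hv => ?_
    have e1 := Φ.right_inv (𝓠.localSection v₀.1 v.1)
    rw [Atiyah.evalAt_eq _ (hζp v hv)]
    simp only [Function.comp_apply]
    rw [Atiyah.evalAt_eq _ (hζp' v hv)]
    exact congrArg (fun w : Q => (TotalSpace.mk w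
      (mfderiv 𝓘(ℝ, FP) 𝓘(ℝ, FQ) Φ.toFun (Φ.invFun (𝓠.localSection v₀.1 v.1))
        ((D.toFun v.1 v.2).eval ⟨_, hζp' v hv⟩) : FQ) : TangentBundle 𝓘(ℝ, FQ) Q)) e1.symm

/-! #### Pullback of connections -/

/-- The pullback of a connection `D` along `f : N → M`: the connection on `f*P` whose composition
with `At(f*P) → f*At(P)` is `v ↦ D (df v)`. -/
def _root_.Connection.pullback (D : Connection 𝓟) (f : C^∞⟮𝓘(ℝ, FN), N; 𝓘(ℝ, FM), M⟯) :
    Connection (𝓟.pullback f) where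
  toFun := 𝓟.lift f fun n => (D.toFun (f n)).comp (mfderiv 𝓘(ℝ, FN) 𝓘(ℝ, FM) f n)
  eta_comp n := by
    ext v
    exact 𝓟.eta_lift f _ n v
  contMDiff := by
    refine 𝓟.contMDiff_lift f (fun n v => ?_) ?_
    · exact DFunLike.congr_fun (D.eta_comp (f n)) (mfderiv 𝓘(ℝ, FN) 𝓘(ℝ, FM) f n v)
    · exact D.contMDiff.comp (f.contMDiff.contMDiff_tangentMap (by simp))

theorem _root_.Connection.atiyahPullback_pullback (D : Connection 𝓟)
    (f : C^∞⟮𝓘(ℝ, FN), N; 𝓘(ℝ, FM), M⟯) (n : N) (v : TangentSpace 𝓘(ℝ, FN) n) :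
    𝓟.atiyahPullback f n ((D.pullback f).toFun n v) =
      D.toFun (f n) (mfderiv 𝓘(ℝ, FN) 𝓘(ℝ, FM) f n v) :=
  𝓟.atiyahPullback_lift f (L := fun n => (D.toFun (f n)).comp (mfderiv 𝓘(ℝ, FN) 𝓘(ℝ, FM) f n))
    (fun n v => DFunLike.congr_fun (D.eta_comp (f n)) (mfderiv 𝓘(ℝ, FN) 𝓘(ℝ, FM) f n v)) n v

/-! #### The adjoint bundle -/

section Ad

variable (𝓟)

/-- The fibre over `x` of the adjoint bundle `ad(P)`, the kernel of `At(P) → TM`. -/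
abbrev Ad (x : M) : Submodule ℝ (𝓟.Atiyah x) := LinearMap.ker (𝓟.eta x).toLinearMap

theorem ad_le_ker {x : M} (κ : 𝓟.Atiyah x →ₗ[ℝ] 𝓟.Ad x) (hκ : ∀ a : 𝓟.Ad x, κ a = a) :
    𝓟.Ad x ≤ LinearMap.ker (LinearMap.id - (𝓟.Ad x).subtype ∘ₗ κ) := fun a ha => by
  rw [LinearMap.mem_ker]
  exact sub_eq_zero.2 (congrArg Subtype.val (hκ ⟨a, ha⟩)).symm

/-- The right splitting `D` of the Atiyah sequence at `x` attached to a left splitting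
`κ : At(P) → ad(P)`: it is given by `D (η a) = a - κ a`, so it is the right splitting with image
the kernel of `κ`. -/
def splittingOfProjection {x : M} (κ : 𝓟.Atiyah x →ₗ[ℝ] 𝓟.Ad x) (hκ : ∀ a : 𝓟.Ad x, κ a = a) :
    TangentSpace 𝓘(ℝ, FM) x →L[ℝ] 𝓟.Atiyah x :=
  haveI : FiniteDimensional ℝ (TangentSpace 𝓘(ℝ, FM) x) := inferInstanceAs (FiniteDimensional ℝ FM)
  haveI : T2Space (TangentSpace 𝓘(ℝ, FM) x) := inferInstanceAs (T2Space FM)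
  LinearMap.toContinuousLinearMap
    ((𝓟.Ad x).liftQ (LinearMap.id - (𝓟.Ad x).subtype ∘ₗ κ) (𝓟.ad_le_ker κ hκ) ∘ₗ
    ((𝓟.eta x).toLinearMap.quotKerEquivOfSurjective (𝓟.surjective_eta x)).symm.toLinearMap)

theorem splittingOfProjection_eta {x : M} (κ : 𝓟.Atiyah x →ₗ[ℝ] 𝓟.Ad x)
    (hκ : ∀ a : 𝓟.Ad x, κ a = a) (a : 𝓟.Atiyah x) :
    𝓟.splittingOfProjection κ hκ (𝓟.eta x a) = a - κ a := by
  have h : ((𝓟.eta x).toLinearMap.quotKerEquivOfSurjective (𝓟.surjective_eta x)).symm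
      (𝓟.eta x a) = Submodule.Quotient.mk a := by
    rw [LinearEquiv.symm_apply_eq]
    rfl
  exact congrArg ((𝓟.Ad x).liftQ (LinearMap.id - (𝓟.Ad x).subtype ∘ₗ κ)
    (𝓟.ad_le_ker κ hκ)) h

theorem eta_splittingOfProjection {x : M} (κ : 𝓟.Atiyah x →ₗ[ℝ] 𝓟.Ad x)
    (hκ : ∀ a : 𝓟.Ad x, κ a = a) (v : TangentSpace 𝓘(ℝ, FM) x) :
    𝓟.eta x (𝓟.splittingOfProjection κ hκ v) = v := by
  obtain ⟨a, rfl⟩ := 𝓟.surjective_eta x v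
  rw [splittingOfProjection_eta, map_sub, show 𝓟.eta x (κ a) = 0 from (κ a).2, sub_zero]

variable {𝓟} in
theorem splittingOfProjection_eq {x : M} (κ : 𝓟.Atiyah x →ₗ[ℝ] 𝓟.Ad x)
    (hκ : ∀ a : 𝓟.Ad x, κ a = a) {v : TangentSpace 𝓘(ℝ, FM) x} {a : 𝓟.Atiyah x}
    (ha : 𝓟.eta x a = v) (h : κ a = 0) : 𝓟.splittingOfProjection κ hκ v = a := by
  rw [← ha, splittingOfProjection_eta, h, ZeroMemClass.coe_zero, sub_zero]

variable (f : C^∞⟮𝓘(ℝ, FN), N; 𝓘(ℝ, FM), M⟯)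

theorem eta_atiyahPullback {n : N} (a : (𝓟.pullback f).Atiyah n) :
    𝓟.eta (f n) (𝓟.atiyahPullback f n a) =
      mfderiv 𝓘(ℝ, FN) 𝓘(ℝ, FM) f n ((𝓟.pullback f).eta n a) := by
  let z : 𝓟.Fiber (f n) := ⟨𝓟.basePoint (f n), 𝓟.proj_basePoint (f n)⟩
  rw [eta_apply _ z, eta_apply a (𝓟.pullbackPoint z), atiyahPullback_eval]
  have h1 := mfderiv_comp (𝓟.pullbackPoint z).1 (𝓟.mdifferentiableAt_proj z.1)
    ((𝓟.contMDiff_pullback_snd f).mdifferentiable (by simp) (𝓟.pullbackPoint z).1)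
  have h2 := mfderiv_comp (𝓟.pullbackPoint z).1 (f.contMDiff.mdifferentiable (by simp) n)
    ((𝓟.contMDiff_pullback_fst f).mdifferentiable (by simp) (𝓟.pullbackPoint z).1)
  have h3 : 𝓟.proj ∘ (fun q : 𝓟.Pullback f => q.1.2) = f ∘ (fun q : 𝓟.Pullback f => q.1.1) :=
    funext fun q => q.2.symm
  rw [h3] at h1
  exact DFunLike.congr_fun (h1.symm.trans h2) (a.eval (𝓟.pullbackPoint z))

/-- The natural isomorphism `ad(f*P) = f*ad(P)`, the restriction of `At(f*P) → f*At(P)`. -/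
def adPullback (n : N) : (𝓟.pullback f).Ad n ≃ₗ[ℝ] 𝓟.Ad (f n) :=
  LinearEquiv.ofBijective
    ((𝓟.atiyahPullback f n).toLinearMap.restrict (q := 𝓟.Ad (f n)) fun a ha => by
      have ha : (𝓟.pullback f).eta n a = 0 := ha
      change 𝓟.eta (f n) (𝓟.atiyahPullback f n a) = 0
      rw [eta_atiyahPullback, ha, map_zero]) (by
    constructor
    · intro a b hab
      exact Subtype.ext (atiyahPullback_ext
        ((show (𝓟.pullback f).eta n a = 0 from a.2).trans
          (show (𝓟.pullback f).eta n b = 0 from b.2).symm) (congrArg Subtype.val hab))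
    · intro b
      have hb : 𝓟.eta (f n) b.1 = 0 := b.2
      let z : 𝓟.Fiber (f n) := ⟨𝓟.basePoint (f n), 𝓟.proj_basePoint (f n)⟩
      let a := ((𝓟.pullback f).evalEquiv (𝓟.pullbackPoint z)).symm
        (𝓟.liftTangent f (𝓟.pullbackPoint z).1 (0, b.1.eval z))
      have hae : a.eval (𝓟.pullbackPoint z) =
          𝓟.liftTangent f (𝓟.pullbackPoint z).1 (0, b.1.eval z) :=
        ((𝓟.pullback f).evalEquiv (𝓟.pullbackPoint z)).apply_symm_apply _
      have ha : (𝓟.pullback f).eta n a = 0 := by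
        rw [eta_apply _ (𝓟.pullbackPoint z), hae]
        exact 𝓟.mfderiv_fst_liftTangent f (𝓟.pullbackPoint z).1 0 (b.1.eval z)
      refine ⟨⟨a, ha⟩, Subtype.ext ((𝓟.evalEquiv z).injective ?_)⟩
      change (𝓟.atiyahPullback f n a).eval z = b.1.eval z
      rw [atiyahPullback_eval, hae]
      refine 𝓟.mfderiv_snd_liftTangent f (𝓟.pullbackPoint z).1 0 (b.1.eval z) ?_
      exact (map_zero (mfderiv 𝓘(ℝ, FN) 𝓘(ℝ, FM) f n)).trans (hb.symm.trans (eta_apply b.1 z)))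

theorem coe_adPullback (n : N) (a : (𝓟.pullback f).Ad n) :
    (𝓟.adPullback f n a : 𝓟.Atiyah (f n)) = 𝓟.atiyahPullback f n a := rfl

theorem adPullback_ext {n : N} {a b : (𝓟.pullback f).Ad n}
    (h : 𝓟.atiyahPullback f n a = 𝓟.atiyahPullback f n b) : a = b :=
  (𝓟.adPullback f n).injective (Subtype.ext h)

theorem coe_adPullback_symm (n : N) (b : 𝓟.Ad (f n)) :
    𝓟.atiyahPullback f n ((𝓟.adPullback f n).symm b) = b :=
  congrArg Subtype.val ((𝓟.adPullback f n).apply_symm_apply b)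

end Ad

/-! #### The tautological connection -/

variable (𝓟)

/-- The model vector space of the manifold `𝒞(P)`. -/
abbrev ConnModel (FM FP : Type*) [NormedAddCommGroup FM] [NormedSpace ℝ FM]
    [NormedAddCommGroup FP] [NormedSpace ℝ FP] : Type _ := FM × (FM →L[ℝ] VerticalModel FM FP)

theorem contMDiff_connection_coe : ContMDiff 𝓘(ℝ, ConnModel FM FP)
    (𝓘(ℝ, FM).prod 𝓘(ℝ, FM →L[ℝ] FP)) ∞ (fun c : 𝓟.ConnectionBundle => c.1) :=
  LocalSlice.contMDiff_coe 𝓟.connectionSlice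

/-- The projection `δ : 𝒞(P) → M`. -/
def delta : C^∞⟮𝓘(ℝ, ConnModel FM FP), 𝓟.ConnectionBundle; 𝓘(ℝ, FM), M⟯ :=
  ⟨fun c => c.1.1, (Bundle.contMDiff_proj (IB := 𝓘(ℝ, FM)) (n := ∞) (F := FM →L[ℝ] FP)
    (fun x : M => TangentSpace 𝓘(ℝ, FM) x →L[ℝ] 𝓟.Atiyah x)).comp 𝓟.contMDiff_connection_coe⟩

variable {𝓟} in
/-- A point `c` of `𝒞(P)` over `x` is a splitting `T_xM → At(P)_x` of the Atiyah sequence at `x`. -/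
def ConnectionBundle.splitting (c : 𝓟.ConnectionBundle) :
    TangentSpace 𝓘(ℝ, FM) (𝓟.delta c) →L[ℝ] 𝓟.Atiyah (𝓟.delta c) := c.1.2

variable {𝓟} in
theorem ConnectionBundle.eta_splitting (c : 𝓟.ConnectionBundle)
    (v : TangentSpace 𝓘(ℝ, FM) (𝓟.delta c)) : 𝓟.eta (𝓟.delta c) (c.splitting v) = v :=
  DFunLike.congr_fun (show (𝓟.eta c.1.1).comp c.1.2 = _ from c.2) v

variable {𝓟} in
/-- The tautological homomorphism `β : δ*At(P) → δ*ad(P)`: at a point `c` of `𝒞(P)`, it is the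
projection onto `ad(P) = ker (At(P) → TM)` whose kernel is the image of the splitting `c`. -/
def beta (c : 𝓟.ConnectionBundle) : 𝓟.Atiyah (𝓟.delta c) →ₗ[ℝ] 𝓟.Ad (𝓟.delta c) :=
  (LinearMap.id - c.splitting.toLinearMap ∘ₗ (𝓟.eta (𝓟.delta c)).toLinearMap).codRestrict _
    fun a => by
      rw [LinearMap.mem_ker]
      change 𝓟.eta _ (a - c.splitting (𝓟.eta _ a)) = 0
      rw [map_sub, c.eta_splitting, sub_self]

variable {𝓟} in
theorem ConnectionBundle.sub_splitting_of_eta_eq_zero (c : 𝓟.ConnectionBundle)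
    {a : 𝓟.Atiyah (𝓟.delta c)} (h : 𝓟.eta (𝓟.delta c) a = 0) :
    a - c.splitting (𝓟.eta (𝓟.delta c) a) = a := by
  rw [h, ContinuousLinearMap.map_zero, sub_zero]

variable {𝓟} in
theorem ConnectionBundle.sub_splitting_of_eq (c : 𝓟.ConnectionBundle)
    {a : 𝓟.Atiyah (𝓟.delta c)} {v : TangentSpace 𝓘(ℝ, FM) (𝓟.delta c)} (h : a = c.splitting v) :
    a - c.splitting (𝓟.eta (𝓟.delta c) a) = 0 := by
  rw [h, c.eta_splitting, sub_self]

variable {𝓟} in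
theorem coe_beta (c : 𝓟.ConnectionBundle) (a : 𝓟.Atiyah (𝓟.delta c)) :
    (beta c a : 𝓟.Atiyah (𝓟.delta c)) = a - c.splitting (𝓟.eta (𝓟.delta c) a) := rfl

/-- The composition `β ∘ β' : At(δ*P) → δ*At(P) → δ*ad(P) = ad(δ*P)`. -/
def tautologicalProjection (c : 𝓟.ConnectionBundle) :
    (𝓟.pullback 𝓟.delta).Atiyah c →ₗ[ℝ] (𝓟.pullback 𝓟.delta).Ad c :=
  (𝓟.adPullback 𝓟.delta c).symm.toLinearMap ∘ₗ beta c ∘ₗ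
    (𝓟.atiyahPullback 𝓟.delta c).toLinearMap

theorem atiyahPullback_tautologicalProjection (c : 𝓟.ConnectionBundle)
    (a : (𝓟.pullback 𝓟.delta).Atiyah c) :
    𝓟.atiyahPullback 𝓟.delta c (𝓟.tautologicalProjection c a) =
      𝓟.atiyahPullback 𝓟.delta c a - c.splitting (𝓟.eta (𝓟.delta c)
        (𝓟.atiyahPullback 𝓟.delta c a)) :=
  𝓟.coe_adPullback_symm 𝓟.delta c (beta c (𝓟.atiyahPullback 𝓟.delta c a))

theorem tautologicalProjection_coe (c : 𝓟.ConnectionBundle) (a : (𝓟.pullback 𝓟.delta).Ad c) :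
    𝓟.tautologicalProjection c a = a := by
  refine 𝓟.adPullback_ext 𝓟.delta ?_
  have h : 𝓟.eta (𝓟.delta c) (𝓟.atiyahPullback 𝓟.delta c a) = 0 := (𝓟.adPullback 𝓟.delta c a).2
  exact (𝓟.atiyahPullback_tautologicalProjection c _).trans
    (c.sub_splitting_of_eta_eq_zero h)

/-- The right splitting attached to `β ∘ β'` is `v ↦ c (dδ v)`, in terms of its image under
`At(δ*P) → δ*At(P)`. -/
theorem splittingOfProjection_tautological (c : 𝓟.ConnectionBundle)
    (v : TangentSpace 𝓘(ℝ, ConnModel FM FP) c) :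
    (𝓟.pullback 𝓟.delta).splittingOfProjection (𝓟.tautologicalProjection c)
      (𝓟.tautologicalProjection_coe c) v =
    𝓟.lift 𝓟.delta (fun c => c.splitting.comp
      (mfderiv 𝓘(ℝ, ConnModel FM FP) 𝓘(ℝ, FM) 𝓟.delta c)) c v := by
  have h : 𝓟.atiyahPullback 𝓟.delta c (𝓟.lift 𝓟.delta (fun c => c.splitting.comp
      (mfderiv 𝓘(ℝ, ConnModel FM FP) 𝓘(ℝ, FM) 𝓟.delta c)) c v) =
      c.splitting (mfderiv 𝓘(ℝ, ConnModel FM FP) 𝓘(ℝ, FM) 𝓟.delta c v) :=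
    𝓟.atiyahPullback_lift 𝓟.delta (L := fun c => c.splitting.comp
      (mfderiv 𝓘(ℝ, ConnModel FM FP) 𝓘(ℝ, FM) 𝓟.delta c)) (fun c v => c.eta_splitting _) c v
  refine splittingOfProjection_eq _ _ (𝓟.eta_lift 𝓟.delta _ c v) ?_
  refine 𝓟.adPullback_ext 𝓟.delta ?_
  refine (𝓟.atiyahPullback_tautologicalProjection c _).trans ?_
  refine (c.sub_splitting_of_eq h).trans ?_
  exact (ContinuousLinearMap.map_zero (𝓟.atiyahPullback 𝓟.delta c)).symm

/-- The tautological connection `𝒟₀` on `δ*P → 𝒞(P)`: the splitting of the Atiyah sequence of `δ*P`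
given by the projection `β ∘ β' : At(δ*P) → ad(δ*P)`. -/
def tautologicalConnection : Connection (𝓟.pullback 𝓟.delta) where
  toFun c := (𝓟.pullback 𝓟.delta).splittingOfProjection (𝓟.tautologicalProjection c)
    (𝓟.tautologicalProjection_coe c)
  eta_comp c := by
    ext v
    exact (𝓟.pullback 𝓟.delta).eta_splittingOfProjection _ _ v
  contMDiff := by
    have h1 : ContMDiff 𝓘(ℝ, ConnModel FM FP).tangent 𝓘(ℝ, FM).tangent ∞
        (fun v : TangentBundle 𝓘(ℝ, ConnModel FM FP) 𝓟.ConnectionBundle =>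
          (⟨𝓟.delta v.1, mfderiv 𝓘(ℝ, ConnModel FM FP) 𝓘(ℝ, FM) 𝓟.delta v.1 v.2⟩ :
            TangentBundle 𝓘(ℝ, FM) M)) := 𝓟.delta.contMDiff.contMDiff_tangentMap (by simp)
    have h2 : ContMDiff 𝓘(ℝ, ConnModel FM FP).tangent (𝓘(ℝ, FM).prod 𝓘(ℝ, FM →L[ℝ] FP)) ∞
        (fun v : TangentBundle 𝓘(ℝ, ConnModel FM FP) 𝓟.ConnectionBundle =>
          (⟨𝓟.delta v.1, v.1.splitting⟩ : 𝓟.HomBundle)) :=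
      𝓟.contMDiff_connection_coe.comp (Bundle.contMDiff_proj (IB := 𝓘(ℝ, ConnModel FM FP)) (n := ∞)
        (F := ConnModel FM FP) (TangentSpace 𝓘(ℝ, ConnModel FM FP) : 𝓟.ConnectionBundle → Type _))
    have h3 := 𝓟.contMDiff_lift 𝓟.delta (L := fun c => c.splitting.comp
      (mfderiv 𝓘(ℝ, ConnModel FM FP) 𝓘(ℝ, FM) 𝓟.delta c)) (fun c v => c.eta_splitting _)
      (ContMDiff.clm_bundle_apply h2 h1)
    exact h3.congr fun v => congrArg (TotalSpace.mk v.1)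
      (𝓟.splittingOfProjection_tautological v.1 v.2)

/-! #### The connection defined by a section of `𝒞(P)` -/

variable (σ : C^∞⟮𝓘(ℝ, FM), M; 𝓘(ℝ, ConnModel FM FP), 𝓟.ConnectionBundle⟯)
  (hσ : ∀ x, 𝓟.delta (σ x) = x)

theorem mk_cast {x y : M} (h : y = x) (A : TangentSpace 𝓘(ℝ, FM) y →L[ℝ] 𝓟.Atiyah y) :
    (⟨x, h ▸ A⟩ : 𝓟.HomBundle) = ⟨y, A⟩ := by
  subst h
  rfl

/-- The connection `x ↦ σ x` on `P` corresponding to a smooth section `σ` of `𝒞(P) → M`. -/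
def sectionConnection : Connection 𝓟 where
  toFun x := hσ x ▸ (σ x).splitting
  eta_comp x := by
    have h : ∀ (y : M) (hy : y = x) (A : TangentSpace 𝓘(ℝ, FM) y →L[ℝ] 𝓟.Atiyah y),
        (𝓟.eta y).comp A = ContinuousLinearMap.id ℝ (TangentSpace 𝓘(ℝ, FM) y) →
        (𝓟.eta x).comp (hy ▸ A) = ContinuousLinearMap.id ℝ (TangentSpace 𝓘(ℝ, FM) x) := by
      rintro _ rfl A hA
      exact hA
    exact h _ (hσ x) _ (σ x).2
  contMDiff := by
    have hπ := Bundle.contMDiff_proj (IB := 𝓘(ℝ, FM)) (n := ∞) (F := FM)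
      (TangentSpace 𝓘(ℝ, FM) : M → Type _)
    have h1 : ContMDiff 𝓘(ℝ, FM) (𝓘(ℝ, FM).prod 𝓘(ℝ, FM →L[ℝ] FP)) ∞
        (fun x => (⟨x, hσ x ▸ (σ x).splitting⟩ : 𝓟.HomBundle)) := by
      refine (𝓟.contMDiff_connection_coe.comp σ.contMDiff).congr fun x => ?_
      exact 𝓟.mk_cast (hσ x) _
    exact ContMDiff.clm_bundle_apply (h1.comp hπ) contMDiff_id

/-- The identification of `σ*δ*P` with `P`, for a section `σ` of `δ : 𝒞(P) → M`. -/
def sectionPullbackIso : Iso ((𝓟.pullback 𝓟.delta).pullback σ) 𝓟 where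
  toFun q := q.1.2.1.2
  invFun z := ⟨(𝓟.proj z, ⟨(σ (𝓟.proj z), z), hσ (𝓟.proj z)⟩), rfl⟩
  left_inv q := by
    have h1 : σ q.1.1 = q.1.2.1.1 := q.2
    have h2 : 𝓟.delta q.1.2.1.1 = 𝓟.proj q.1.2.1.2 := q.1.2.2
    have h3 : 𝓟.proj q.1.2.1.2 = q.1.1 := by rw [← h2, ← h1, hσ]
    refine Subtype.ext (Prod.ext h3 (Subtype.ext (Prod.ext ?_ rfl)))
    change σ (𝓟.proj q.1.2.1.2) = q.1.2.1.1
    rw [h3, h1]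
  right_inv z := rfl
  contMDiff_toFun := (𝓟.contMDiff_pullback_snd 𝓟.delta).comp
    ((𝓟.pullback 𝓟.delta).contMDiff_pullback_snd σ)
  contMDiff_invFun := by
    intro z
    refine LocalSlice.contMDiffWithinAt_of_coe ((𝓟.pullback 𝓟.delta).pullbackSlice σ) ?_
    refine (𝓟.contMDiff_proj z).prodMk ?_
    refine LocalSlice.contMDiffWithinAt_of_coe (𝓟.pullbackSlice 𝓟.delta) ?_
    exact ((σ.contMDiff.comp 𝓟.contMDiff_proj) z).prodMk contMDiffAt_id
  proj_toFun q := by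
    have h1 : σ q.1.1 = q.1.2.1.1 := q.2
    have h2 : 𝓟.delta q.1.2.1.1 = 𝓟.proj q.1.2.1.2 := q.1.2.2
    change 𝓟.proj q.1.2.1.2 = q.1.1
    rw [← h2, ← h1, hσ]
  act_toFun q g := rfl

end PrincipalBundle

end

/-!
Both connections are compared after evaluation at a point `z` of the fibre of `P` over `x`, where
an element of `At(P)_x` is determined by its value in `T_zP`. Write `a` for the lift of a tangent
vector `v` at `x` given by `σ*𝒟₀`. The identification `σ*δ*P = P` is the composition of the two
projections `σ*δ*P → δ*P → P`, so by the chain rule it sends `a` to `β'_δ (β'_σ a)`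
(`eval_atiyahMap_sectionPullbackIso`). The defining property of a pullback connection gives
`β'_σ a = 𝒟₀ (dσ v)`, and `𝒟₀` satisfies `β'_δ (𝒟₀ w) = c (dδ w)` at a point `c` of `𝒞(P)`
(`atiyahPullback_tautologicalConnection`). Since `δ ∘ σ = id`, the result is `σ x (dδ (dσ v)) = σ x v`.
The fibres of `At(P)` over `x` and over `δ (σ x)` are equal but not definitionally so;
`eval_cast_apply` removes the transport between them.
-/

namespace PrincipalBundle

variable {FG : Type*} [NormedAddCommGroup FG] [NormedSpace ℝ FG] [FiniteDimensional ℝ FG]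
    {G : Type*} [TopologicalSpace G] [ChartedSpace FG G] [Group G] [LieGroup 𝓘(ℝ, FG) ∞ G]
    {FM : Type*} [NormedAddCommGroup FM] [NormedSpace ℝ FM] [FiniteDimensional ℝ FM]
    {M : Type*} [TopologicalSpace M] [ChartedSpace FM M] [IsManifold 𝓘(ℝ, FM) ∞ M]
    {FP : Type*} [NormedAddCommGroup FP] [NormedSpace ℝ FP] [FiniteDimensional ℝ FP]
    {P : Type*} [TopologicalSpace P] [ChartedSpace FP P] [IsManifold 𝓘(ℝ, FP) ∞ P]
    (𝓟 : PrincipalBundle FG G FM M FP P)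
    (σ : C^∞⟮𝓘(ℝ, FM), M; 𝓘(ℝ, ConnModel FM FP), 𝓟.ConnectionBundle⟯)

/-- The connection `𝒟₀` is characterized by `β'_δ (𝒟₀ w) = c (dδ w)` for `w` tangent to `𝒞(P)` at
`c`. -/
theorem atiyahPullback_tautologicalConnection (c : 𝓟.ConnectionBundle)
    (w : TangentSpace 𝓘(ℝ, ConnModel FM FP) c) :
    𝓟.atiyahPullback 𝓟.delta c (𝓟.tautologicalConnection.toFun c w) =
      c.splitting (mfderiv 𝓘(ℝ, ConnModel FM FP) 𝓘(ℝ, FM) 𝓟.delta c w) :=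
  (congrArg (𝓟.atiyahPullback 𝓟.delta c) (𝓟.splittingOfProjection_tautological c w)).trans
    (𝓟.atiyahPullback_lift 𝓟.delta (L := fun c => c.splitting.comp
      (mfderiv 𝓘(ℝ, ConnModel FM FP) 𝓘(ℝ, FM) 𝓟.delta c)) (fun c _ => c.eta_splitting _) c w)

/-- Moving a homomorphism `T_yM → At(P)_y` along an equality `y = x` does not change its values at
the points of the fibre; here `v` is read as a vector of the model space, which is every tangent
space. -/
theorem eval_cast_apply {x y : M} (h : y = x) (A : TangentSpace 𝓘(ℝ, FM) y →L[ℝ] 𝓟.Atiyah y)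
    (v : FM) (z : P) (hx : 𝓟.proj z = x) (hy : 𝓟.proj z = y) :
    (Atiyah.eval ((h ▸ A : TangentSpace 𝓘(ℝ, FM) x →L[ℝ] 𝓟.Atiyah x) v) ⟨z, hx⟩ : FP) =
      Atiyah.eval (A v) ⟨z, hy⟩ := by
  subst h
  rfl

variable {𝓟 σ} in
theorem mfderiv_delta_mfderiv_section (hσ : ∀ x, 𝓟.delta (σ x) = x) (x : M)
    (v : TangentSpace 𝓘(ℝ, FM) x) :
    (mfderiv 𝓘(ℝ, ConnModel FM FP) 𝓘(ℝ, FM) 𝓟.delta (σ x)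
      (mfderiv 𝓘(ℝ, FM) 𝓘(ℝ, ConnModel FM FP) σ x v) : FM) = v := by
  have h := mfderiv_comp x (𝓟.delta.contMDiff.mdifferentiable (by simp) (σ x))
    (σ.contMDiff.mdifferentiable (by simp) x)
  have hid : 𝓟.delta ∘ σ = id := funext hσ
  rw [hid, mfderiv_id] at h
  exact (DFunLike.congr_fun h v).symm

/-- Under `σ*δ*P = P`, an element `a` of `At(σ*δ*P)_x` corresponds to `β'_δ (β'_σ a)`. -/
theorem eval_atiyahMap_sectionPullbackIso (hσ : ∀ x, 𝓟.delta (σ x) = x) {x : M}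
    (a : ((𝓟.pullback 𝓟.delta).pullback σ).Atiyah x) (z : P) (hx : 𝓟.proj z = x)
    (hy : 𝓟.proj z = 𝓟.delta (σ x)) :
    (((𝓟.sectionPullbackIso σ hσ).atiyahMap x a).eval ⟨z, hx⟩ : FP) =
      (𝓟.atiyahPullback 𝓟.delta (σ x)
        ((𝓟.pullback 𝓟.delta).atiyahPullback σ x a)).eval ⟨z, hy⟩ := by
  -- With `x` replaced by `proj z`, the point of `σ*δ*P` over `z` is `(x, (σ x, z))` by definition.
  subst hx
  let z' : 𝓟.Fiber (𝓟.delta (σ (𝓟.proj z))) := ⟨z, hy⟩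
  let q := (𝓟.pullback 𝓟.delta).pullbackPoint (𝓟.pullbackPoint z')
  have h := mfderiv_comp q.1
    ((𝓟.contMDiff_pullback_snd 𝓟.delta).mdifferentiable (by simp) q.1.1.2)
    (((𝓟.pullback 𝓟.delta).contMDiff_pullback_snd σ).mdifferentiable (by simp) q.1)
  exact DFunLike.congr_fun h (a.eval q)

end PrincipalBundle

theorem lemma3p4
    {FG : Type*} [NormedAddCommGroup FG] [NormedSpace ℝ FG] [FiniteDimensional ℝ FG]
    {G : Type*} [TopologicalSpace G] [ChartedSpace FG G] [Group G] [LieGroup 𝓘(ℝ, FG) ∞ G]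
    {FM : Type*} [NormedAddCommGroup FM] [NormedSpace ℝ FM] [FiniteDimensional ℝ FM]
    {M : Type*} [TopologicalSpace M] [ChartedSpace FM M] [IsManifold 𝓘(ℝ, FM) ∞ M]
    {FP : Type*} [NormedAddCommGroup FP] [NormedSpace ℝ FP] [FiniteDimensional ℝ FP]
    {P : Type*} [TopologicalSpace P] [ChartedSpace FP P] [IsManifold 𝓘(ℝ, FP) ∞ P]
    (𝓟 : PrincipalBundle FG G FM M FP P)
    (σ : C^∞⟮𝓘(ℝ, FM), M; 𝓘(ℝ, PrincipalBundle.ConnModel FM FP), 𝓟.ConnectionBundle⟯)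
    (hσ : ∀ x, 𝓟.delta (σ x) = x) :
    𝓟.sectionConnection σ hσ =
      (𝓟.tautologicalConnection.pullback σ).transport (𝓟.sectionPullbackIso σ hσ) := by
  refine Connection.ext (funext fun x => ContinuousLinearMap.ext fun v => ?_)
  let z := 𝓟.basePoint x
  have hx : 𝓟.proj z = x := 𝓟.proj_basePoint x
  have hy : 𝓟.proj z = 𝓟.delta (σ x) := hx.trans (hσ x).symm
  refine (𝓟.evalEquiv ⟨z, hx⟩).injective ?_
  refine (𝓟.eval_cast_apply (hσ x) (σ x).splitting v z hx hy).trans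
    (Eq.trans ?_ (𝓟.eval_atiyahMap_sectionPullbackIso σ hσ
      ((𝓟.tautologicalConnection.pullback σ).toFun x v) z hx hy).symm)
  refine congrArg (fun b : 𝓟.Atiyah (𝓟.delta (σ x)) => b.eval ⟨z, hy⟩) ?_
  rw [Connection.atiyahPullback_pullback]
  refine Eq.trans ?_ (𝓟.atiyahPullback_tautologicalConnection (σ x) _).symm
  exact congrArg (σ x).splitting (PrincipalBundle.mfderiv_delta_mfderiv_section hσ x v).symm
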